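/- All graphs are simple, undirected and connected, possibly infinite and not locally finite; $d$ is the graph distance. A graph $G$ is \emph{weakly modular} if for every vertex $u$: (TC) any two vertices $v,w$ with $1=d(v,w)<d(u,v)=d(u,w)$ have a common neighbour $x$ with $d(u,x)=d(u,v)-1$; (QC) for any vertices $v,w,z$ with $d(v,z)=d(w,z)=1$ and $2=d(v,w)\le d(u,v)=d(u,w)=d(u,z)-1$, the vertices $v,w$ have a common neighbour $x$ with $d(u,x)=d(u,v)-1$. It is \emph{locally weakly modular} if for every vertex $u$: any two adjacent vertices $v,w$ with $d(u,v)=d(u,w)=2$ have a common neighbour that is also adjacent to $u$; and for any vertices $v,w,z$ with $z\sim v,w$ and $d(v,w)=d(u,v)=d(u,w)=d(u,z)-1=2$, the vertices $u,v,w$ have a common neighbour. The \emph{triangle-square complex} $X(G)$ of $G$ is the two-dimensional cell complex with 1-skeleton $G$ obtained by attaching a solid triangle along every triangle of $G$ and a solid square along every induced 4-cycle of $G$. Theorem. Let $G$ be a graph. If $G$ is locally weakly modular, then the 1-skeleton $\widetilde G$ of the universal cover of $X(G)$ is weakly modular. Moreover, $G$ is weakly modular if and only if $G$ is locally weakly modular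 and $X(G)$ is simply connected. -/

import Mathlib

universe u w

namespace WeakMod

section Graphs

variable {V : Type u}

/-- Triangle condition `TC(u)`: if `1 = d(v,w) < d(u,v) = d(u,w)`, then `v` and `w` have a common
neighbour `x` with `d(u,x) = d(u,v) - 1`. -/
def TriangleCondition (G : SimpleGraph V) (u : V) : Prop :=
  ∀ v w : V, G.dist v w = 1 → 1 < G.dist u v → G.dist u v = G.dist u w →
    ∃ x : V, G.Adj x v ∧ G.Adj x w ∧ G.dist u x + 1 = G.dist u v

/-- Quadrangle condition `QC(u)`: if `d(v,z) = d(w,z) = 1` and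
`2 = d(v,w) ≤ d(u,v) = d(u,w) = d(u,z) - 1`, then `v` and `w` have a common neighbour `x`
with `d(u,x) = d(u,v) - 1`. -/
def QuadrangleCondition (G : SimpleGraph V) (u : V) : Prop :=
  ∀ v w z : V, G.dist v z = 1 → G.dist w z = 1 → G.dist v w = 2 →
    2 ≤ G.dist u v → G.dist u v = G.dist u w → G.dist u z = G.dist u v + 1 →
    ∃ x : V, G.Adj x v ∧ G.Adj x w ∧ G.dist u x + 1 = G.dist u v

/-- A graph is weakly modular if it satisfies `TC(u)` and `QC(u)` for every vertex `u`. -/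
def IsWeaklyModular (G : SimpleGraph V) : Prop :=
  ∀ u : V, TriangleCondition G u ∧ QuadrangleCondition G u

/-- Local triangle condition `LTC(u)`: if `v`, `w` are adjacent and `d(u,v) = d(u,w) = 2`, then
`u`, `v`, `w` have a common neighbour. -/
def LocalTriangleCondition (G : SimpleGraph V) (u : V) : Prop :=
  ∀ v w : V, G.Adj v w → G.dist u v = 2 → G.dist u w = 2 →
    ∃ x : V, G.Adj x u ∧ G.Adj x v ∧ G.Adj x w

/-- Local quadrangle condition `LQC(u)`: if `z` is adjacent to `v` and `w` and
`d(v,w) = d(u,v) = d(u,w) = d(u,z) - 1 = 2`, then `u`, `v`, `w` have a common neighbour. -/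
def LocalQuadrangleCondition (G : SimpleGraph V) (u : V) : Prop :=
  ∀ v w z : V, G.Adj z v → G.Adj z w → G.dist v w = 2 → G.dist u v = 2 → G.dist u w = 2 →
    G.dist u z = 3 → ∃ x : V, G.Adj x u ∧ G.Adj x v ∧ G.Adj x w

/-- A graph is locally weakly modular if it satisfies `LTC(u)` and `LQC(u)` for every
vertex `u`. -/
def IsLocallyWeaklyModular (G : SimpleGraph V) : Prop :=
  ∀ u : V, LocalTriangleCondition G u ∧ LocalQuadrangleCondition G u

/-- `a`, `b`, `c` are the vertices of a triangle of `G`. -/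
def IsTriangle (G : SimpleGraph V) (a b c : V) : Prop :=
  G.Adj a b ∧ G.Adj b c ∧ G.Adj a c

/-- `(a, b, c, d)` is a square of `G`, that is, an induced 4-cycle. -/
def IsInducedSquare (G : SimpleGraph V) (a b c d : V) : Prop :=
  (G.Adj a b ∧ G.Adj b c ∧ G.Adj c d ∧ G.Adj d a) ∧
    (a ≠ c ∧ ¬ G.Adj a c) ∧ (b ≠ d ∧ ¬ G.Adj b d)

end Graphs

section Complex

variable {V : Type u}

/-- The parametrized closed cells of the triangle-square complex of `G`: vertices, edges, solid
triangles and solid squares. The vertices of a cell are listed in order, so a geometric cell occurs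
once for every symmetry of its shape; all its occurrences have the same image below. -/
inductive Cell (G : SimpleGraph V) : Type u
  | vertex (v : V) : Cell G
  | edge (a b : V) (h : G.Adj a b) : Cell G
  | triangle (a b c : V) (h : IsTriangle G a b c) : Cell G
  | square (a b c d : V) (h : IsInducedSquare G a b c d) : Cell G

variable {G : SimpleGraph V}

/-- The model of a closed cell: a point, the interval `[0,1]`, the standard 2-simplex, or the
square `[0,1] × [0,1]`. -/
def Cell.Model : Cell G → Type
  | .vertex _ => Unit
  | .edge _ _ _ => unitInterval
  | .triangle _ _ _ _ => stdSimplex ℝ (Fin 3)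
  | .square _ _ _ _ _ => unitInterval × unitInterval

instance Cell.instTopologicalSpaceModel (K : Cell G) : TopologicalSpace K.Model :=
  match K with
  | .vertex _ => inferInstanceAs (TopologicalSpace Unit)
  | .edge _ _ _ => inferInstanceAs (TopologicalSpace unitInterval)
  | .triangle _ _ _ _ => inferInstanceAs (TopologicalSpace (stdSimplex ℝ (Fin 3)))
  | .square _ _ _ _ _ => inferInstanceAs (TopologicalSpace (unitInterval × unitInterval))

/-- The coordinates of the points of a cell: barycentric on vertices, edges and triangles, and
bilinear on squares. These maps are injective, the image of the interior of a cell consists of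
points whose support is the whole vertex set of the cell, and this vertex set determines the cell
of the complex (a square is an induced 4-cycle, hence determined by its four vertices). So two
cells have exactly their common faces in common. -/
noncomputable def Cell.coords : (K : Cell G) → K.Model → (V →₀ ℝ)
  | .vertex v, _ => Finsupp.single v 1
  | .edge a b _, (t : unitInterval) => Finsupp.single a (1 - (t : ℝ)) + Finsupp.single b (t : ℝ)
  | .triangle a b c _, (y : stdSimplex ℝ (Fin 3)) =>
      Finsupp.single a (y.1 0) + Finsupp.single b (y.1 1) + Finsupp.single c (y.1 2)
  | .square a b c d _, (y : unitInterval × unitInterval) =>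
      Finsupp.single a ((1 - (y.1 : ℝ)) * (1 - (y.2 : ℝ))) +
      Finsupp.single b ((y.1 : ℝ) * (1 - (y.2 : ℝ))) +
      Finsupp.single c ((y.1 : ℝ) * (y.2 : ℝ)) +
      Finsupp.single d ((1 - (y.1 : ℝ)) * (y.2 : ℝ))

variable (G) in
/-- The triangle-square complex of `G`, as a space: the union of its vertices, its edges, a solid
triangle on every triangle of `G` and a solid square on every induced 4-cycle of `G`. -/
def TriangleSquareComplex : Type u :=
  {x : V →₀ ℝ // ∃ (K : Cell G) (y : K.Model), K.coords y = x}

/-- The characteristic map of a closed cell. -/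
noncomputable def Cell.charMap (K : Cell G) (y : K.Model) : TriangleSquareComplex G :=
  ⟨K.coords y, K, y, rfl⟩

/-- The CW (weak) topology: a set is open if and only if its preimage in every closed cell is
open. -/
noncomputable instance TriangleSquareComplex.instTopologicalSpace :
    TopologicalSpace (TriangleSquareComplex G) :=
  ⨆ K : Cell G, TopologicalSpace.coinduced K.charMap inferInstance

variable (G) in
/-- The point of the complex given by a vertex of `G`. -/
noncomputable def vertexPoint (v : V) : TriangleSquareComplex G :=
  (Cell.vertex v).charMap ()

/-- The standard linear parametrization over `[0,1]` of the edge from `a` to `b`. -/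
noncomputable def edgePoint {a b : V} (h : G.Adj a b) (t : unitInterval) :
    TriangleSquareComplex G :=
  (Cell.edge a b h).charMap t

theorem vertexPoint_injective : Function.Injective (vertexPoint G) := by
  intro a b h
  exact Finsupp.single_left_injective one_ne_zero (congrArg Subtype.val h)

theorem edgePoint_zero {a b : V} (h : G.Adj a b) : edgePoint h 0 = vertexPoint G a := by
  apply Subtype.ext
  simp [edgePoint, vertexPoint, Cell.charMap, Cell.coords]

theorem edgePoint_one {a b : V} (h : G.Adj a b) : edgePoint h 1 = vertexPoint G b := by
  apply Subtype.ext
  simp [edgePoint, vertexPoint, Cell.charMap, Cell.coords]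

theorem edgePoint_symm {a b : V} (h : G.Adj a b) (t : unitInterval) :
    edgePoint h.symm t = edgePoint h (unitInterval.symm t) := by
  apply Subtype.ext
  simp [edgePoint, Cell.charMap, Cell.coords, add_comm]

variable {E : Type w} [TopologicalSpace E]

/-- `p : E → X` exhibits `E` as a universal cover of the triangle-square complex `X` of `G`:
a surjective covering map with simply connected total space. -/
structure IsUniversalCover (p : E → TriangleSquareComplex G) : Prop where
  isCoveringMap : IsCoveringMap p
  surjective : Function.Surjective p
  simplyConnected : SimplyConnectedSpace E

/-- The 1-skeleton of a covering space `p : E → X` of the triangle-square complex `X` of `G`, for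
the cell structure on `E` whose cells are the lifts of the cells of `X`: the vertices are the
points over vertices of `X`, and two of them are adjacent if they are the ends of a lift of
an edge of `X`. -/
def oneSkeleton (p : E → TriangleSquareComplex G) :
    SimpleGraph {e : E // ∃ v : V, p e = vertexPoint G v} where
  Adj e f := ∃ (a b : V) (h : G.Adj a b) (γ : C(unitInterval, E)),
    γ 0 = e.1 ∧ γ 1 = f.1 ∧ ∀ t : unitInterval, p (γ t) = edgePoint h t
  symm := ⟨by
    rintro e f ⟨a, b, h, γ, h0, h1, hγ⟩
    refine ⟨b, a, h.symm, γ.comp ⟨unitInterval.symm, unitInterval.continuous_symm⟩, ?_, ?_, ?_⟩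
    · simpa using h1
    · simpa using h0
    · intro t
      rw [edgePoint_symm]
      exact hγ _⟩
  loopless := ⟨by
    rintro e ⟨a, b, h, γ, h0, h1, hγ⟩
    apply h.ne
    apply vertexPoint_injective (G := G)
    rw [← edgePoint_zero h, ← edgePoint_one h, ← hγ, ← hγ, h0, h1]⟩

end Complex

end WeakMod

/-! A locally weakly modular graph `G` is unfolded from a base vertex `v₀`, one layer at a time. A
vertex above `t` is given by a neighbour `z` of `t` in `G` that neither equals nor is adjacent to
the projection of a lower neighbour of `t`. Two such vertices with the same `z` are identified when
the vertices below them have a common lower neighbour. Within a layer, two vertices are adjacent if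
their projections are and they have a common lower neighbour.

With layers in the role of distances from the base, the unfolding satisfies the triangle condition
at its base by construction. The quadrangle condition says that two lower neighbours of a vertex
have a common lower neighbour; this is half of `Layer.joined_and_interpolate`, where the local
conditions do their main work. The other half lifts common neighbours in `G` of vertices two layers
apart. Together they show that neighbours, triangles and 4-cycles lift uniquely from `G`
(`Unfolding.isCellCovering`), so the unfolding induces a topological covering of triangle-square
complexes (`IsCellCovering.isCoveringMap`).

Let `K` be a graph over `G` whose vertices and edges are points and paths of a simply connected
space `E` over the complex of `G`. If `K` covers `G`, it inherits the local conditions, and path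
lifting gives a section of every unfolding of `K` (`exists_section`). A section forces distance from
the base to equal the layer, so both conditions at an arbitrary base vertex of `K` are read off from
its unfolding. Taking for `E` the universal cover gives the first claim; taking the complex of `G`
itself gives one direction of the equivalence.

Conversely, in a weakly modular graph two geodesics from `v₀` with the same end are homotopic across
triangles and squares (`IsGeodesicClass.eq`), and geodesics to the ends of an edge differ by that
edge. Hence edge paths with the same ends are homotopic. Every path between vertices is homotopic to
an edge path (`isEdgeClass`), because open stars contract radially to their centres, cell by cell.
-/

namespace WeakMod

/-! ### The layers of the unfolding and their local structure -/

section Tower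

variable {V : Type u} {G : SimpleGraph V}

/-- `z` is at distance at least three from `r`. -/
def Far (G : SimpleGraph V) (r z : V) : Prop :=
  r ≠ z ∧ ¬ G.Adj r z ∧ ∀ y, G.Adj r y → ¬ G.Adj y z

theorem dist_eq_two {a b c : V} (h₁ : G.Adj a b) (h₂ : G.Adj b c) (hne : a ≠ c)
    (hna : ¬ G.Adj a c) : G.dist a c = 2 := by
  have hr : G.Reachable a c := ⟨.cons h₁ (.cons h₂ .nil)⟩
  have h := SimpleGraph.dist_le (SimpleGraph.Walk.cons h₁ (.cons h₂ .nil))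
  have h' := hr.one_lt_dist_of_ne_of_not_adj hne hna
  simp at h
  omega

theorem exists_of_dist_eq_two {a c : V} (h : G.dist a c = 2) :
    a ≠ c ∧ ¬ G.Adj a c ∧ ∃ b, G.Adj a b ∧ G.Adj b c := by
  refine ⟨?_, ?_, ?_⟩
  · rintro rfl; simp at h
  · intro h'; rw [SimpleGraph.dist_eq_one_iff_adj.2 h'] at h; omega
  · have hr : G.Reachable a c := by
      by_contra h'; rw [SimpleGraph.dist_eq_zero_of_not_reachable h'] at h; omega
    obtain ⟨p, hp⟩ := hr.exists_walk_length_eq_dist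
    rw [h] at hp
    match p, hp with
    | .cons h₁ (.cons h₂ .nil), _ => exact ⟨_, h₁, h₂⟩

theorem dist_eq_three {a b c d : V} (h₁ : G.Adj a b) (h₂ : G.Adj b c) (h₃ : G.Adj c d)
    (hf : Far G a d) : G.dist a d = 3 := by
  have hr : G.Reachable a d := ⟨.cons h₁ (.cons h₂ (.cons h₃ .nil))⟩
  have h := SimpleGraph.dist_le (SimpleGraph.Walk.cons h₁ (.cons h₂ (.cons h₃ .nil)))
  have h' := hr.one_lt_dist_of_ne_of_not_adj hf.1 hf.2.1
  simp at h
  have h'' : G.dist a d ≠ 2 := fun h'' => by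
    obtain ⟨-, -, b, hb, hb'⟩ := exists_of_dist_eq_two h''
    exact hf.2.2 b hb hb'
  omega

theorem far_of_dist_eq_three {a d : V} (h : G.dist a d = 3) : Far G a d := by
  refine ⟨?_, ?_, ?_⟩
  · rintro rfl; simp at h
  · intro h'; rw [SimpleGraph.dist_eq_one_iff_adj.2 h'] at h; omega
  · intro y h₁ h₂
    have := SimpleGraph.dist_le (SimpleGraph.Walk.cons h₁ (.cons h₂ .nil))
    simp at this
    omega

/-- The local triangle condition in terms of adjacency. -/
theorem IsLocallyWeaklyModular.exists_triangle (hG : IsLocallyWeaklyModular G) {u v w a b : V}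
    (hvw : G.Adj v w) (hua : G.Adj u a) (hav : G.Adj a v) (hub : G.Adj u b) (hbw : G.Adj b w)
    (huv : u ≠ v) (huv' : ¬ G.Adj u v) (huw : u ≠ w) (huw' : ¬ G.Adj u w) :
    ∃ x, G.Adj u x ∧ G.Adj x v ∧ G.Adj x w := by
  obtain ⟨x, h₁, h₂, h₃⟩ := (hG u).1 v w hvw (dist_eq_two hua hav huv huv')
    (dist_eq_two hub hbw huw huw')
  exact ⟨x, h₁.symm, h₂, h₃⟩

/-- The local conditions below a vertex at distance three. -/
theorem IsLocallyWeaklyModular.exists_of_far (hG : IsLocallyWeaklyModular G) {u v w z a b : V}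
    (hvz : G.Adj v z) (hwz : G.Adj w z) (hvw : v ≠ w)
    (hua : G.Adj u a) (hav : G.Adj a v) (hub : G.Adj u b) (hbw : G.Adj b w)
    (hf : Far G u z) : ∃ x, G.Adj u x ∧ G.Adj x v ∧ G.Adj x w := by
  have huv : u ≠ v := by rintro rfl; exact hf.2.1 hvz
  have huw : u ≠ w := by rintro rfl; exact hf.2.1 hwz
  have huv' : ¬ G.Adj u v := fun h => hf.2.2 v h hvz
  have huw' : ¬ G.Adj u w := fun h => hf.2.2 w h hwz
  by_cases h : G.Adj v w
  · exact hG.exists_triangle h hua hav hub hbw huv huv' huw huw'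
  · obtain ⟨x, h₁, h₂, h₃⟩ := (hG u).2 v w z hvz.symm hwz.symm (dist_eq_two hvz hwz.symm hvw h)
      (dist_eq_two hua hav huv huv') (dist_eq_two hub hbw huw huw') (dist_eq_three hua hav hvz hf)
    exact ⟨x, h₁.symm, h₂, h₃⟩

/-- Two consecutive layers of the unfolding of a graph at a vertex: the upper layer `S`, the lower
layer `T`, their projections to the graph, and the adjacency between them. -/
structure Stage (V : Type u) where
  S : Type u
  T : Type u
  f : S → V
  g : T → V
  D : S → T → Prop

/-- The vertex `z` extends the vertex `t` of the upper layer to the next layer. -/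
def Stage.Valid (G : SimpleGraph V) (A : Stage V) (t : A.S) (z : V) : Prop :=
  G.Adj (A.f t) z ∧ ∀ u, A.D t u → A.g u ≠ z ∧ ¬ G.Adj (A.g u) z

/-- Two extensions agree if they have the same projection, and extend the same vertex or vertices
with a common lower neighbour. -/
def Stage.Rel (G : SimpleGraph V) (A : Stage V) (p q : {p : A.S × V // A.Valid G p.1 p.2}) :
    Prop :=
  p.1.2 = q.1.2 ∧ (p.1.1 = q.1.1 ∨ ∃ u, A.D p.1.1 u ∧ A.D q.1.1 u)

/-- The next pair of layers. -/
def Stage.next (G : SimpleGraph V) (A : Stage V) : Stage V where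
  -- `Stage.Rel` is not known to be transitive at this point, so this is the quotient by the
  -- equivalence it generates; `Layer.Above.joined` compares the two.
  S := Quot (A.Rel G)
  T := A.S
  f := Quot.lift (fun p => p.1.2) (fun _ _ h => h.1)
  g := A.f
  D w t := ∃ z h, w = Quot.mk _ ⟨(t, z), h⟩

/-- The pairs of consecutive layers of the unfolding of `G` at `v₀`. -/
def stage (G : SimpleGraph V) (v₀ : V) : ℕ → Stage V
  -- The layer below layer 0 is empty, so that every neighbour of `v₀` extends the base vertex.
  | 0 => ⟨PUnit, PEmpty, fun _ => v₀, PEmpty.elim, fun _ _ => False⟩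
  | n + 1 => (stage G v₀ n).next G

/-- The `n`-th layer of the unfolding of `G` at `v₀`. -/
def Layer (G : SimpleGraph V) (v₀ : V) (n : ℕ) : Type u := (stage G v₀ n).S

namespace Layer

variable {v₀ : V} {n : ℕ}

/-- The projection of a layer to the graph. -/
def val : {n : ℕ} → Layer G v₀ n → V := fun {n} => (stage G v₀ n).f

/-- `w.Above t` says that `w` is adjacent to `t`, a vertex of the layer below. -/
def Above (w : Layer G v₀ (n + 1)) (t : Layer G v₀ n) : Prop := (stage G v₀ (n + 1)).D w t

/-- `z` is the projection of a vertex above `t`. -/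
def Valid : {n : ℕ} → Layer G v₀ n → V → Prop := fun {n} => (stage G v₀ n).Valid G

theorem valid_zero {t : Layer G v₀ 0} {z : V} : t.Valid z ↔ G.Adj t.val z :=
  ⟨fun h => h.1, fun h => ⟨h, fun _ h => h.elim⟩⟩

theorem valid_succ {t : Layer G v₀ (n + 1)} {z : V} :
    t.Valid z ↔ G.Adj t.val z ∧ ∀ u : Layer G v₀ n, t.Above u → u.val ≠ z ∧ ¬ G.Adj u.val z :=
  Iff.rfl

theorem Valid.adj {t : Layer G v₀ n} {z : V} (h : t.Valid z) : G.Adj t.val z := h.1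

theorem Above.valid {w : Layer G v₀ (n + 1)} {t : Layer G v₀ n} (h : w.Above t) :
    t.Valid w.val := by
  obtain ⟨z, h, rfl⟩ := h
  exact h

theorem Above.adj {w : Layer G v₀ (n + 1)} {t : Layer G v₀ n} (h : w.Above t) :
    G.Adj t.val w.val := h.valid.adj

theorem Valid.exists_above {t : Layer G v₀ n} {z : V} (h : t.Valid z) :
    ∃ w : Layer G v₀ (n + 1), w.Above t ∧ w.val = z :=
  ⟨Quot.mk _ ⟨(t, z), h⟩, ⟨z, h, rfl⟩, rfl⟩

theorem Above.eq {w w' : Layer G v₀ (n + 1)} {t : Layer G v₀ n} (h : w.Above t)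
    (h' : w'.Above t) (hv : w.val = w'.val) : w = w' := by
  obtain ⟨z, h, rfl⟩ := h
  obtain ⟨z', h', rfl⟩ := h'
  obtain rfl : z = z' := hv
  rfl

theorem exists_above (w : Layer G v₀ (n + 1)) : ∃ t : Layer G v₀ n, w.Above t := by
  obtain ⟨⟨⟨t, z⟩, h⟩, rfl⟩ := Quot.exists_rep w
  exact ⟨t, z, h, rfl⟩

theorem eq_of_zero (t s : Layer G v₀ 0) : t = s := by
  cases t; cases s; rfl

/-- Equal or with a common lower neighbour. -/
def Joined (t s : Layer G v₀ (n + 1)) : Prop :=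
  t = s ∨ ∃ r : Layer G v₀ n, t.Above r ∧ s.Above r

theorem Above.above_of_valid {w : Layer G v₀ (n + 2)} {t s : Layer G v₀ (n + 1)} (h : w.Above t)
    (hs : s.Valid w.val) (hts : ∃ r : Layer G v₀ n, t.Above r ∧ s.Above r) : w.Above s := by
  obtain ⟨z, h, rfl⟩ := h
  exact ⟨z, hs, Quot.sound ⟨rfl, Or.inr hts⟩⟩

/-- Lower neighbours of one vertex are related only by the equivalence that `Stage.Rel` generates.
The hypothesis `htrans` says that on the vertices extended by a fixed `z` this relation is already
transitive, so generating adds nothing. -/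
theorem Above.joined {w : Layer G v₀ (n + 2)} {t s : Layer G v₀ (n + 1)} (ht : w.Above t)
    (hs : w.Above s)
    (htrans : ∀ (z : V) (a b c : Layer G v₀ (n + 1)), a.Valid z → b.Valid z → c.Valid z →
      Joined a b → Joined b c → Joined a c) : Joined t s := by
  obtain ⟨z, ht, rfl⟩ := ht
  obtain ⟨z', hs, h⟩ := hs
  have key : ∀ p q, Relation.EqvGen ((stage G v₀ (n + 1)).Rel G) p q →
      p.1.2 = q.1.2 ∧ Joined (G := G) (v₀ := v₀) (n := n) p.1.1 q.1.1 := by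
    intro p q hpq
    induction hpq with
    | rel p q h => exact h
    | refl p => exact ⟨rfl, Or.inl rfl⟩
    | symm p q _ ih =>
      refine ⟨ih.1.symm, ?_⟩
      rcases ih.2 with h | ⟨r, h, h'⟩
      exacts [Or.inl h.symm, Or.inr ⟨r, h', h⟩]
    | trans p q r _ _ ih ih' =>
      refine ⟨ih.1.trans ih'.1, htrans p.1.2 _ _ _ p.2 ?_ ?_ ih.2 ih'.2⟩
      · rw [ih.1]; exact q.2
      · rw [ih.1, ih'.1]; exact r.2
  exact (key _ _ (Quot.eqvGen_exact h)).2

/-- Validity looks one layer down; this gains a second layer. If `r` were adjacent to `z`, then `z`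
itself would lift below `w`. If they had a common neighbour, the local triangle condition at `r` for
the edge from `w` to `z` would give a neighbour of `z` that lifts below `w`. Both contradict the
validity of `z`. -/
theorem interpolate_far
    (hG : IsLocallyWeaklyModular G)
    (ih : ∀ (r : Layer G v₀ n) (t : Layer G v₀ (n + 1)) (w : Layer G v₀ (n + 2)) (x : V),
      t.Above r → w.Above t → G.Adj r.val x → G.Adj x w.val →
      ∃ y : Layer G v₀ (n + 1), y.Above r ∧ w.Above y ∧ y.val = x)
    {r : Layer G v₀ n} {t : Layer G v₀ (n + 1)} {w : Layer G v₀ (n + 2)} {z : V}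
    (htr : t.Above r) (hwt : w.Above t) (hz : w.Valid z) : Far G r.val z := by
  have h₁ := valid_succ.1 hz
  have h₂ := valid_succ.1 hwt.valid
  have hrz : ¬ G.Adj r.val z := fun h => by
    obtain ⟨y, -, hy, rfl⟩ := ih r t w z htr hwt h h₁.1.symm
    exact (h₁.2 y hy).1 rfl
  have hrz' : r.val ≠ z := by
    intro h
    exact (h₁.2 t hwt).2 (h ▸ htr.adj.symm)
  refine ⟨hrz', hrz, fun y hy hyz => ?_⟩
  obtain ⟨x, hx₁, hx₂, hx₃⟩ := hG.exists_triangle h₁.1 htr.adj hwt.adj hy hyz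
    (h₂.2 r htr).1 (h₂.2 r htr).2 hrz' hrz
  obtain ⟨y', -, hy', rfl⟩ := ih r t w x htr hwt hx₁ hx₂
  exact (h₁.2 y' hy').2 hx₃

/-- The two statements feed each other. Interpolation makes validity into distance three, where the
local conditions apply and yield the transitivity of the gluing; the gluing in turn controls all
lower neighbours of an interpolated vertex, which makes it valid. -/
theorem joined_and_interpolate (hG : IsLocallyWeaklyModular G) (v₀ : V) (n : ℕ) :
    (∀ (w : Layer G v₀ (n + 2)) (t s : Layer G v₀ (n + 1)), w.Above t → w.Above s →
      Joined t s) ∧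
    (∀ (r : Layer G v₀ n) (t : Layer G v₀ (n + 1)) (w : Layer G v₀ (n + 2)) (x : V),
      t.Above r → w.Above t → G.Adj r.val x → G.Adj x w.val →
      ∃ y : Layer G v₀ (n + 1), y.Above r ∧ w.Above y ∧ y.val = x) := by
  induction n with
  | zero =>
    refine ⟨fun w t s ht hs => ht.joined hs ?_, fun r t w x htr hwt hrx hxw => ?_⟩
    · intro z a b c _ _ _ _ _
      obtain ⟨r, hr⟩ := a.exists_above
      obtain ⟨r', hr'⟩ := c.exists_above
      obtain rfl := eq_of_zero r r'
      exact Or.inr ⟨r, hr, hr'⟩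
    · obtain ⟨y, hy, rfl⟩ := (valid_zero.2 hrx).exists_above
      refine ⟨y, hy, hwt.above_of_valid (valid_succ.2 ⟨hxw, fun u _ => ?_⟩) ⟨r, htr, hy⟩, rfl⟩
      obtain rfl := eq_of_zero u r
      exact (valid_succ.1 hwt.valid).2 _ htr
  | succ n ih =>
    obtain ⟨ihE, ihI⟩ := ih
    refine ⟨fun w t s ht hs => ht.joined hs ?_, fun r t w x htr hwt hrx hxw => ?_⟩
    · rintro z a b c ha hb hc (rfl | ⟨t, hat, hbt⟩) (rfl | ⟨s, hbs, hcs⟩)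
      · exact Or.inl rfl
      · exact Or.inr ⟨s, hbs, hcs⟩
      · exact Or.inr ⟨t, hat, hbt⟩
      -- Both `t` and `s` lie below `b`, so they share a lower neighbour `r`, two layers below `a`,
      -- `b` and `c` and hence far from `z`.
      rcases ihE b t s hbt hbs with rfl | ⟨r, htr, hsr⟩
      · exact Or.inr ⟨t, hat, hcs⟩
      have hf := interpolate_far hG ihI htr hat ha
      by_cases hac : a.val = c.val
      · obtain ⟨s', hs'r, has', hs's⟩ := ihI r t a s.val htr hat hsr.adj (hac ▸ hcs.adj)
        obtain rfl := hs'r.eq hsr hs's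
        exact Or.inr ⟨s', has', hcs⟩
      -- The local conditions at `r` give a common neighbour of `r`, `a` and `c` in the graph. It
      -- lifts below `a` and below `c`, and both lifts agree because they lie above `r`.
      · obtain ⟨x, hx₁, hx₂, hx₃⟩ := hG.exists_of_far ha.adj hc.adj hac htr.adj hat.adj hsr.adj
          hcs.adj hf
        obtain ⟨y, hyr, hay, rfl⟩ := ihI r t a x htr hat hx₁ hx₂
        obtain ⟨y', hyr', hcy', hy⟩ := ihI r s c y.val hsr hcs hx₁ hx₃
        obtain rfl := hyr'.eq hyr hy
        exact Or.inr ⟨y', hay, hcy'⟩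
    · have hfar : ∀ u : Layer G v₀ n, r.Above u → Far G u.val w.val := fun u hu =>
        interpolate_far hG ihI hu htr hwt.valid
      have hrx' : r.Valid x := valid_succ.2 ⟨hrx, fun u hu =>
        ⟨fun h => (hfar u hu).2.1 (h ▸ hxw), fun h => (hfar u hu).2.2 x h hxw⟩⟩
      obtain ⟨y, hy, rfl⟩ := hrx'.exists_above
      refine ⟨y, hy, hwt.above_of_valid (valid_succ.2 ⟨hxw, fun r' hr' => ?_⟩) ⟨r, htr, hy⟩, rfl⟩
      -- Any other lower neighbour `r'` of `y` shares a lower neighbour `u` with `r`, and `u` is far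
      -- from `w`.
      rcases ihE y r r' hy hr' with rfl | ⟨u, hu, hu'⟩
      · exact (valid_succ.1 hwt.valid).2 _ htr
      · exact ⟨fun h => (hfar u hu).2.1 (h ▸ hu'.adj), (hfar u hu).2.2 _ hu'.adj⟩

theorem Above.joined_of_above (hG : IsLocallyWeaklyModular G) {w : Layer G v₀ (n + 2)}
    {t s : Layer G v₀ (n + 1)} (ht : w.Above t) (hs : w.Above s) :
    t = s ∨ ∃ r : Layer G v₀ n, t.Above r ∧ s.Above r :=
  (joined_and_interpolate hG v₀ n).1 w t s ht hs

theorem Above.exists_between (hG : IsLocallyWeaklyModular G) {r : Layer G v₀ n}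
    {t : Layer G v₀ (n + 1)} {w : Layer G v₀ (n + 2)} {x : V} (htr : t.Above r)
    (hwt : w.Above t) (hrx : G.Adj r.val x) (hxw : G.Adj x w.val) :
    ∃ y : Layer G v₀ (n + 1), y.Above r ∧ w.Above y ∧ y.val = x :=
  (joined_and_interpolate hG v₀ n).2 r t w x htr hwt hrx hxw

theorem Above.between (hG : IsLocallyWeaklyModular G) {r : Layer G v₀ n}
    {t y : Layer G v₀ (n + 1)} {w : Layer G v₀ (n + 2)} (htr : t.Above r)
    (hwt : w.Above t) (hyr : y.Above r) (hyw : G.Adj y.val w.val) : w.Above y := by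
  obtain ⟨y', h, h', hy⟩ := htr.exists_between hG hwt hyr.adj hyw
  obtain rfl := h.eq hyr hy
  exact h'

theorem Above.far (hG : IsLocallyWeaklyModular G) {r : Layer G v₀ n} {t : Layer G v₀ (n + 1)}
    {w : Layer G v₀ (n + 2)} {z : V} (htr : t.Above r) (hwt : w.Above t) (hz : w.Valid z) :
    Far G r.val z :=
  interpolate_far hG (joined_and_interpolate hG v₀ n).2 htr hwt hz

end Layer

end Tower


/-! ### Coverings of triangle-square complexes in terms of graphs -/

section Covering

variable {V W : Type*}

/-- `f : H → G` is a covering of triangle-square complexes, in terms of graphs: neighbours,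
triangles and 4-cycles lift uniquely. -/
structure IsCellCovering (H : SimpleGraph W) (G : SimpleGraph V) (f : W → V) : Prop where
  map_adj {a b : W} : H.Adj a b → G.Adj (f a) (f b)
  exists_lift {a : W} {z : V} : G.Adj (f a) z → ∃ b, H.Adj a b ∧ f b = z
  unique {a b c : W} : H.Adj a b → H.Adj a c → f b = f c → b = c
  triangle {a b c : W} : H.Adj a b → H.Adj a c → G.Adj (f b) (f c) → H.Adj b c
  square {a b c : W} {z : V} : H.Adj a b → H.Adj a c → G.Adj (f b) z → G.Adj (f c) z →
    ∃ d, H.Adj b d ∧ H.Adj c d ∧ f d = z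

/-- The lifting of 4-cycles follows from that of induced ones. -/
theorem exists_square_lift_of_induced {H : SimpleGraph W} {G : SimpleGraph V} {f : W → V}
    (exists_lift : ∀ {a : W} {z : V}, G.Adj (f a) z → ∃ b, H.Adj a b ∧ f b = z)
    (unique : ∀ {a b c : W}, H.Adj a b → H.Adj a c → f b = f c → b = c)
    (triangle : ∀ {a b c : W}, H.Adj a b → H.Adj a c → G.Adj (f b) (f c) → H.Adj b c)
    {a b c : W} {z : V} (hab : H.Adj a b) (hac : H.Adj a c) (hbz : G.Adj (f b) z)
    (hcz : G.Adj (f c) z)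
    (square : f b ≠ f c → ¬ G.Adj (f b) (f c) → f a ≠ z → ¬ G.Adj (f a) z →
      ∃ d, H.Adj b d ∧ H.Adj c d ∧ f d = z) : ∃ d, H.Adj b d ∧ H.Adj c d ∧ f d = z := by
  by_cases h₁ : f b = f c
  · obtain rfl := unique hab hac h₁
    obtain ⟨d, hd, rfl⟩ := exists_lift hbz
    exact ⟨d, hd, hd, rfl⟩
  by_cases h₂ : G.Adj (f b) (f c)
  · obtain ⟨d, hd, rfl⟩ := exists_lift hbz
    exact ⟨d, hd, triangle (triangle hab hac h₂) hd hcz, rfl⟩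
  by_cases h₃ : f a = z
  · exact ⟨a, hab.symm, hac.symm, h₃⟩
  by_cases h₄ : G.Adj (f a) z
  · obtain ⟨d, hd, rfl⟩ := exists_lift h₄
    exact ⟨d, triangle hab hd hbz, triangle hac hd hcz, rfl⟩
  exact square h₁ h₂ h₃ h₄

end Covering

/-! ### The unfolding covers the graph -/

section Unfolding

variable {V : Type u} {G : SimpleGraph V} {v₀ : V} {n : ℕ}

namespace Layer

/-- Adjacency in a layer. -/
def Beside (a b : Layer G v₀ (n + 1)) : Prop :=
  G.Adj a.val b.val ∧ ∃ u : Layer G v₀ n, a.Above u ∧ b.Above u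

theorem Beside.symm {a b : Layer G v₀ (n + 1)} (h : a.Beside b) : b.Beside a :=
  ⟨h.1.symm, h.2.imp fun _ h => h.symm⟩

/-- A neighbour `z` fails to be valid because of some lower neighbour `u`: it is `u`, or it is
adjacent to `u`. In the second case `z` lies above `u`, beside `t`; or else it is adjacent to some
`r` below `u`, and interpolating between `r` and `t` puts it below `t`. -/
theorem exists_below_or_beside (hG : IsLocallyWeaklyModular G) {t : Layer G v₀ (n + 1)} {z : V}
    (hz : G.Adj t.val z) (hv : ¬ t.Valid z) :
    (∃ s : Layer G v₀ n, t.Above s ∧ s.val = z) ∨ ∃ b, t.Beside b ∧ b.val = z := by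
  rw [valid_succ] at hv
  push Not at hv
  obtain ⟨u, hu, h⟩ := hv hz
  by_cases huz : u.val = z
  · exact Or.inl ⟨u, hu, huz⟩
  replace h := h huz
  by_cases hv' : u.Valid z
  · obtain ⟨b, hb, rfl⟩ := hv'.exists_above
    exact Or.inr ⟨b, ⟨hz, u, hu, hb⟩, rfl⟩
  obtain _ | n := n
  · exact (hv' (valid_zero.2 h)).elim
  rw [valid_succ] at hv'
  push Not at hv'
  obtain ⟨r, hr, h'⟩ := hv' h
  have hrz : r.val ≠ z := by
    rintro rfl
    exact ((valid_succ.1 hu.valid).2 r hr).2 hz.symm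
  obtain ⟨y, -, hy, h⟩ := hr.exists_between hG hu (h' hrz) hz.symm
  exact Or.inl ⟨y, hy, h⟩

theorem Above.eq_below (hG : IsLocallyWeaklyModular G) {t : Layer G v₀ (n + 1)}
    {a b : Layer G v₀ n} (ha : t.Above a) (hb : t.Above b) (h : a.val = b.val) : a = b := by
  obtain _ | n := n
  · exact eq_of_zero a b
  rcases ha.joined_of_above hG hb with rfl | ⟨r, hr, hr'⟩
  exacts [rfl, hr.eq hr' h]

theorem Beside.eq (hG : IsLocallyWeaklyModular G) {t a b : Layer G v₀ (n + 1)}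
    (ha : t.Beside a) (hb : t.Beside b) (h : a.val = b.val) : a = b := by
  obtain ⟨hta, u, htu, hau⟩ := ha
  obtain ⟨htb, u', htu', hbu'⟩ := hb
  obtain _ | n := n
  · obtain rfl := eq_of_zero u u'
    exact hau.eq hbu' h
  rcases htu.joined_of_above hG htu' with rfl | ⟨r, hr, hr'⟩
  · exact hau.eq hbu' h
  · exact (hr.between hG hau hr' (h ▸ hbu'.adj)).eq hbu' h

theorem Above.not_valid {t : Layer G v₀ (n + 1)} {u : Layer G v₀ n} (h : t.Above u) {z : V}
    (hz : u.val = z) : ¬ t.Valid z := fun h' => ((valid_succ.1 h').2 u h).1 hz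

theorem Beside.not_valid {t b : Layer G v₀ (n + 1)} (h : t.Beside b) {z : V}
    (hz : b.val = z) : ¬ t.Valid z := by
  subst hz
  obtain ⟨-, u, hu, hu'⟩ := h
  exact fun h' => ((valid_succ.1 h').2 u hu).2 hu'.adj

theorem Above.val_ne_of_beside (hG : IsLocallyWeaklyModular G) {t b : Layer G v₀ (n + 1)}
    {a : Layer G v₀ n} (ha : t.Above a) (hb : t.Beside b) : a.val ≠ b.val := by
  intro h
  obtain ⟨-, u, hu, hu'⟩ := hb
  have hub := hu'.adj
  rw [← h] at hub
  obtain _ | n := n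
  · obtain rfl := eq_of_zero u a
    exact G.loopless.irrefl _ hub
  rcases ha.joined_of_above hG hu with rfl | ⟨r, hr, hr'⟩
  · exact G.loopless.irrefl _ hub
  · exact ((valid_succ.1 hu'.valid).2 r hr').2 (h ▸ hr.adj)

theorem Above.beside (hG : IsLocallyWeaklyModular G) {t : Layer G v₀ (n + 2)}
    {a b : Layer G v₀ (n + 1)} (ha : t.Above a) (hb : t.Above b) (h : G.Adj a.val b.val) :
    a.Beside b := by
  rcases ha.joined_of_above hG hb with rfl | hr
  · exact (G.loopless.irrefl _ h).elim
  · exact ⟨h, hr⟩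

theorem Above.above_of_beside (hG : IsLocallyWeaklyModular G) {t b : Layer G v₀ (n + 1)}
    {a : Layer G v₀ n} (ha : t.Above a) (hb : t.Beside b) (h : G.Adj a.val b.val) :
    b.Above a := by
  obtain ⟨-, u, hu, hu'⟩ := hb
  obtain _ | n := n
  · rwa [eq_of_zero a u]
  rcases ha.joined_of_above hG hu with rfl | ⟨r, hr, hr'⟩
  · exact hu'
  · exact hr'.between hG hu' hr h

theorem Above.valid_beside (hG : IsLocallyWeaklyModular G) {a : Layer G v₀ (n + 2)}
    {t b : Layer G v₀ (n + 1)} (ha : a.Above t) (hb : t.Beside b) (h : G.Adj b.val a.val) :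
    a.Above b := by
  obtain ⟨-, u, hu, hu'⟩ := hb
  refine ha.above_of_valid (valid_succ.2 ⟨h, fun u' hu'' => ?_⟩) ⟨u, hu, hu'⟩
  obtain _ | n := n
  · obtain rfl := eq_of_zero u u'
    exact (valid_succ.1 ha.valid).2 _ hu
  rcases hu'.joined_of_above hG hu'' with rfl | ⟨r, hr, hr'⟩
  · exact (valid_succ.1 ha.valid).2 _ hu
  · have hf := hr.far hG hu ha.valid
    exact ⟨fun h => hf.2.1 (h ▸ hr'.adj), hf.2.2 _ hr'.adj⟩

/-- Only the existence of a common lower neighbour is at stake. When `a` and `b` hang over different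
lower neighbours of `t`, these share a lower neighbour `r`, and the local triangle condition at `r`
for the edge from `a` to `b` provides it. -/
theorem Beside.beside (hG : IsLocallyWeaklyModular G) {t a b : Layer G v₀ (n + 1)}
    (ha : t.Beside a) (hb : t.Beside b) (h : G.Adj a.val b.val) : a.Beside b := by
  refine ⟨h, ?_⟩
  obtain ⟨hta, u, htu, hau⟩ := ha
  obtain ⟨htb, u', htu', hbu'⟩ := hb
  obtain _ | n := n
  · obtain rfl := eq_of_zero u u'
    exact ⟨u, hau, hbu'⟩
  rcases htu.joined_of_above hG htu' with rfl | ⟨r, hr, hr'⟩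
  · exact ⟨u, hau, hbu'⟩
  have h₁ := (valid_succ.1 hau.valid).2 r hr
  have h₂ := (valid_succ.1 hbu'.valid).2 r hr'
  obtain ⟨x, hx₁, hx₂, hx₃⟩ := hG.exists_triangle h hr.adj hau.adj hr'.adj hbu'.adj
    h₁.1 h₁.2 h₂.1 h₂.2
  obtain ⟨y, hy, hy', rfl⟩ := hr.exists_between hG hau hx₁ hx₂
  exact ⟨y, hy', hr'.between hG hbu' hy hx₃⟩

end Layer

variable (G v₀) in
/-- The vertices of the unfolding of `G` at `v₀`. -/
def Unfolding : Type u := Σ n, Layer G v₀ n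

namespace Unfolding

open Layer

/-- The layer of a vertex of the unfolding. -/
def level (a : Unfolding G v₀) : ℕ := a.1

/-- The projection of the unfolding to the graph. -/
def proj (a : Unfolding G v₀) : V := a.2.val

/-- Adjacency in the unfolding. -/
inductive IsAdj : Unfolding G v₀ → Unfolding G v₀ → Prop
  | up {n : ℕ} {w : Layer G v₀ (n + 1)} {t : Layer G v₀ n} : w.Above t → IsAdj ⟨n, t⟩ ⟨n + 1, w⟩
  | down {n : ℕ} {w : Layer G v₀ (n + 1)} {t : Layer G v₀ n} : w.Above t → IsAdj ⟨n + 1, w⟩ ⟨n, t⟩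
  | beside {n : ℕ} {a b : Layer G v₀ (n + 1)} : a.Beside b → IsAdj ⟨n + 1, a⟩ ⟨n + 1, b⟩

theorem IsAdj.symm {a b : Unfolding G v₀} (h : IsAdj a b) : IsAdj b a := by
  cases h with
  | up h => exact .down h
  | down h => exact .up h
  | beside h => exact .beside h.symm

theorem IsAdj.proj {a b : Unfolding G v₀} (h : IsAdj a b) : G.Adj a.proj b.proj := by
  cases h with
  | up h => exact h.adj
  | down h => exact h.adj.symm
  | beside h => exact h.1

variable (G v₀) in
/-- The unfolding of `G` at `v₀`. -/
def graph : SimpleGraph (Unfolding G v₀) where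
  Adj := IsAdj
  symm := ⟨fun _ _ h => h.symm⟩
  loopless := ⟨fun _ h => G.loopless.irrefl _ h.proj⟩

theorem exists_lift (hG : IsLocallyWeaklyModular G) {a : Unfolding G v₀} {z : V}
    (h : G.Adj a.proj z) : ∃ b, (graph G v₀).Adj a b ∧ b.proj = z := by
  obtain ⟨n, a⟩ := a
  by_cases hv : a.Valid z
  · obtain ⟨w, hw, hw'⟩ := hv.exists_above
    exact ⟨⟨_, w⟩, .up hw, hw'⟩
  obtain _ | n := n
  · exact (hv (valid_zero.2 h)).elim
  rcases exists_below_or_beside hG h hv with ⟨s, hs, hs'⟩ | ⟨s, hs, hs'⟩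
  · exact ⟨⟨_, s⟩, .down hs, hs'⟩
  · exact ⟨⟨_, s⟩, .beside hs, hs'⟩

theorem unique (hG : IsLocallyWeaklyModular G) {a b c : Unfolding G v₀}
    (hb : (graph G v₀).Adj a b) (hc : (graph G v₀).Adj a c) (h : b.proj = c.proj) : b = c := by
  cases hb with
  | up hb =>
    cases hc with
    | up hc => rw [hb.eq hc h]
    | down hc => exact (hc.not_valid h.symm hb.valid).elim
    | beside hc => exact (hc.not_valid h.symm hb.valid).elim
  | down hb =>
    cases hc with
    | up hc => exact (hb.not_valid h hc.valid).elim
    | down hc => rw [hb.eq_below hG hc h]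
    | beside hc => exact (hb.val_ne_of_beside hG hc h).elim
  | beside hb =>
    cases hc with
    | up hc => exact (hb.not_valid h hc.valid).elim
    | down hc => exact (hc.val_ne_of_beside hG hb h.symm).elim
    | beside hc => rw [hb.eq hG hc h]

theorem triangle (hG : IsLocallyWeaklyModular G) {a b c : Unfolding G v₀}
    (hb : (graph G v₀).Adj a b) (hc : (graph G v₀).Adj a c) (h : G.Adj b.proj c.proj) :
    (graph G v₀).Adj b c := by
  cases hb with
  | up hb =>
    cases hc with
    | up hc => exact .beside ⟨h, _, hb, hc⟩
    | down hc => exact (((valid_succ.1 hb.valid).2 _ hc).2 h.symm).elim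
    | beside hc => exact .down (hb.valid_beside hG hc h.symm)
  | @down n a b hb =>
    cases hc with
    | up hc => exact (((valid_succ.1 hc.valid).2 _ hb).2 h).elim
    | @down _ _ c hc =>
      obtain _ | n := n
      · rw [eq_of_zero b c] at h
        exact (G.loopless.irrefl _ h).elim
      · exact .beside (hb.beside hG hc h)
    | beside hc => exact .up (hb.above_of_beside hG hc h)
  | beside hb =>
    cases hc with
    | up hc => exact .up (hc.valid_beside hG hb h)
    | down hc => exact .down (hc.above_of_beside hG hb h.symm)
    | beside hc => exact .beside (hb.beside hG hc h)


/-- 4-cycles at `a` lift. -/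
def SquareLift (a : Unfolding G v₀) : Prop :=
  ∀ (b c : Unfolding G v₀) (z : V), (graph G v₀).Adj a b → (graph G v₀).Adj a c →
    G.Adj b.proj z → G.Adj c.proj z →
    ∃ d, (graph G v₀).Adj b d ∧ (graph G v₀).Adj c d ∧ d.proj = z

/-- The position of the lift `d` of `z` next to `b` decides. Above `b`: it is glued to the extension
of `c` through `a`. Below `b`: `d` and `a` share a lower neighbour, so `d` is below `c` too. Beside
`b`: the local triangle condition two layers below `c` gives a common lower neighbour of `c` and
`d`. -/
theorem exists_square_of_up_up (hG : IsLocallyWeaklyModular G) {a : Layer G v₀ n}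
    {b c : Layer G v₀ (n + 1)} {z : V} (hb : b.Above a) (hc : c.Above a) (hbz : G.Adj b.val z)
    (hcz : G.Adj c.val z) (haz : a.val ≠ z) (haz' : ¬ G.Adj a.val z) :
    ∃ d, (graph G v₀).Adj ⟨_, b⟩ d ∧ (graph G v₀).Adj ⟨_, c⟩ d ∧ d.proj = z := by
  by_cases hv : b.Valid z
  · obtain ⟨d, hd, rfl⟩ := hv.exists_above
    refine ⟨⟨_, d⟩, .up hd, .up (hd.above_of_valid (valid_succ.2 ⟨hcz, fun u hu => ?_⟩)
      ⟨a, hb, hc⟩), rfl⟩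
    obtain _ | n := n
    · rw [eq_of_zero u a]
      exact ⟨haz, haz'⟩
    rcases hc.joined_of_above hG hu with rfl | ⟨r, hr, hr'⟩
    · exact ⟨haz, haz'⟩
    · have hf := hr.far hG hb hv
      exact ⟨fun h => hf.2.1 (h ▸ hr'.adj), hf.2.2 _ hr'.adj⟩
  rcases exists_below_or_beside hG hbz hv with ⟨d, hd, rfl⟩ | ⟨d, hd, rfl⟩
  · obtain _ | n := n
    · exact (haz (by rw [eq_of_zero a d])).elim
    rcases hb.joined_of_above hG hd with rfl | ⟨r, hr, hr'⟩
    · exact (haz rfl).elim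
    · exact ⟨⟨_, d⟩, .down hd, .down (hr.between hG hc hr' hcz.symm), rfl⟩
  · obtain ⟨-, u, hbu, hdu⟩ := hd
    have hu : a ≠ u := by
      rintro rfl
      exact haz' hdu.adj
    obtain _ | n := n
    · exact (hu (eq_of_zero a u)).elim
    rcases hb.joined_of_above hG hbu with rfl | ⟨r, hr, hr'⟩
    · exact (hu rfl).elim
    have h₁ := (valid_succ.1 hc.valid).2 r hr
    have h₂ := (valid_succ.1 hdu.valid).2 r hr'
    obtain ⟨x, hx₁, hx₂, hx₃⟩ := hG.exists_triangle hcz hr.adj hc.adj hr'.adj hdu.adj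
      h₁.1 h₁.2 h₂.1 h₂.2
    obtain ⟨y, hy, hcy, rfl⟩ := hr.exists_between hG hc hx₁ hx₂
    exact ⟨⟨_, d⟩, .beside ⟨hbz, u, hbu, hdu⟩, .beside ⟨hcz, y, hcy, hr'.between hG hdu hy hx₃⟩,
      rfl⟩

/-- If `z` is not adjacent to the common lower neighbour `u` of `a` and `c`, the edge from `b` to
`z` is at distance two from `u`, and the local triangle condition replaces `a` by a vertex `y`
adjacent to `z`. The square is then lifted one layer lower, at `u`. -/
theorem exists_square_of_up_beside (hG : IsLocallyWeaklyModular G) {a c : Layer G v₀ (n + 1)}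
    {b : Layer G v₀ (n + 2)} {z : V}
    (ih : ∀ u : Layer G v₀ n, SquareLift ⟨n, u⟩)
    (hb : b.Above a) (hc : a.Beside c) (hbz : G.Adj b.val z)
    (hcz : G.Adj c.val z) (haz' : ¬ G.Adj a.val z) :
    ∃ d, (graph G v₀).Adj ⟨_, b⟩ d ∧ (graph G v₀).Adj ⟨_, c⟩ d ∧ d.proj = z := by
  obtain ⟨hac, u, hau, hcu⟩ := hc
  by_cases huz : G.Adj u.val z
  · obtain ⟨y, hyu, hby, rfl⟩ := hau.exists_between hG hb huz hbz.symm
    exact ⟨⟨_, y⟩, .down hby, triangle (a := ⟨_, u⟩) hG (.up hcu) (.up hyu) hcz, rfl⟩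
  have huz' : u.val ≠ z := by
    rintro rfl
    exact haz' hau.adj.symm
  have h₁ := (valid_succ.1 hb.valid).2 u hau
  obtain ⟨x, hx₁, hx₂, hx₃⟩ := hG.exists_triangle hbz hau.adj hb.adj hcu.adj hcz
      h₁.1 h₁.2 huz' huz
  obtain ⟨y, hyu, hby, rfl⟩ := hau.exists_between hG hb hx₁ hx₂
  obtain ⟨d, hyd, hcd, rfl⟩ := ih u ⟨_, y⟩ ⟨_, c⟩ z (.up hyu) (.up hcu) hx₃ hcz
  exact ⟨d, triangle (a := ⟨_, y⟩) hG (.up hby) hyd hbz, hcd, rfl⟩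

/-- Let `r` lie below the lower neighbours of `a` and `b` and of `a` and `c`. The cases are the
distance from `r` to `z`: one, at least three, or two. In each of them the square is filled by
squares based at vertices of lower layers. -/
theorem exists_square_of_beside_beside (hG : IsLocallyWeaklyModular G) {a b c : Layer G v₀ (n + 1)}
    {z : V} (ih : ∀ m < n + 1, ∀ u : Layer G v₀ m, SquareLift ⟨m, u⟩)
    (hb : a.Beside b) (hc : a.Beside c) (hbc : b.val ≠ c.val) (hbz : G.Adj b.val z)
    (hcz : G.Adj c.val z) :
    ∃ d, (graph G v₀).Adj ⟨_, b⟩ d ∧ (graph G v₀).Adj ⟨_, c⟩ d ∧ d.proj = z := by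
  obtain ⟨hab, u, hau, hbu⟩ := hb
  obtain ⟨hac, u', hau', hcu⟩ := hc
  by_cases huu : u = u'
  · subst huu
    exact ih n (by omega) u _ _ z (.up hbu) (.up hcu) hbz hcz
  obtain _ | n := n
  · exact (huu (eq_of_zero u u')).elim
  rcases hau.joined_of_above hG hau' with h | ⟨r, hr, hr'⟩
  · exact (huu h).elim
  have h₁ := (valid_succ.1 hbu.valid).2 r hr
  have h₂ := (valid_succ.1 hcu.valid).2 r hr'
  have hrz : r.val ≠ z := by
    rintro rfl
    exact h₁.2 hbz.symm
  by_cases hrz' : G.Adj r.val z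
  · obtain ⟨d, hd, rfl⟩ := exists_lift (a := ⟨_, r⟩) hG hrz'
    refine ⟨d, ?_, ?_, rfl⟩
    · obtain ⟨b', hb', hb'', h⟩ := ih n (by omega) r ⟨_, u⟩ d b.val (.up hr) hd hbu.adj hbz.symm
      obtain rfl : b' = ⟨_, b⟩ := unique hG hb' (.up hbu) h
      exact hb''.symm
    · obtain ⟨b', hb', hb'', h⟩ := ih n (by omega) r ⟨_, u'⟩ d c.val (.up hr') hd hcu.adj hcz.symm
      obtain rfl : b' = ⟨_, c⟩ := unique hG hb' (.up hcu) h
      exact hb''.symm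
  by_cases hf : Far G r.val z
  -- A common neighbour of `r`, `b` and `c` replaces the corner `a` by a vertex one layer lower.
  · obtain ⟨x, hx₁, hx₂, hx₃⟩ := hG.exists_of_far hbz hcz hbc hr.adj hbu.adj hr'.adj hcu.adj hf
    obtain ⟨y, hy, hby, rfl⟩ := hr.exists_between hG hbu hx₁ hx₂
    exact ih _ (by omega) y _ _ z (.up hby) (.up (hr'.between hG hcu hy hx₃)) hbz hcz
  · have : ∃ y, G.Adj r.val y ∧ G.Adj y z := by
      by_contra! h
      exact hf ⟨hrz, hrz', h⟩
    -- At distance two, the local triangle condition applies to each of the edges from `b` and `c`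
    -- to `z`, and the square through the two vertices obtained is lifted at `r`.
    obtain ⟨y₀, hy₀, hy₀'⟩ := this
    obtain ⟨x, hx₁, hx₂, hx₃⟩ := hG.exists_triangle hbz hr.adj hbu.adj hy₀ hy₀' h₁.1 h₁.2 hrz hrz'
    obtain ⟨x', hx₁', hx₂', hx₃'⟩ :=
      hG.exists_triangle hcz hr'.adj hcu.adj hy₀ hy₀' h₂.1 h₂.2 hrz hrz'
    obtain ⟨y, hy, hby, rfl⟩ := hr.exists_between hG hbu hx₁ hx₂
    obtain ⟨y', hy', hcy', rfl⟩ := hr'.exists_between hG hcu hx₁' hx₂'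
    obtain ⟨d, hd, hd', rfl⟩ := ih n (by omega) r ⟨_, y⟩ ⟨_, y'⟩ z (.up hy) (.up hy') hx₃ hx₃'
    exact ⟨d, triangle (a := ⟨_, y⟩) hG (.up hby) hd hbz,
      triangle (a := ⟨_, y'⟩) hG (.up hcy') hd' hcz, rfl⟩

theorem squareLift (hG : IsLocallyWeaklyModular G) (n : ℕ) :
    ∀ a : Layer G v₀ n, SquareLift ⟨n, a⟩ := by
  induction n using Nat.strong_induction_on with
  | _ n ih =>
  intro a b c z hab hac hbz hcz
  refine exists_square_lift_of_induced (f := proj) (exists_lift hG) (unique hG) (triangle hG)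
    hab hac hbz hcz fun hbc _ haz haz' => ?_
  -- A square with a lower corner `b` next to `a` is lifted from `b` instead, by induction;
  -- uniqueness identifies the corner opposite to `b` with `c`.
  have hdown : ∀ b c : Unfolding G v₀, (graph G v₀).Adj ⟨n, a⟩ b → (graph G v₀).Adj ⟨n, a⟩ c →
      G.Adj b.proj z → G.Adj c.proj z → b.level < n →
      ∃ d, (graph G v₀).Adj b d ∧ (graph G v₀).Adj c d ∧ d.proj = z := by
    intro b c hab hac hbz hcz hb
    obtain ⟨d, hd, rfl⟩ := exists_lift hG hbz
    obtain ⟨c', hc₁, hc₂, hc₃⟩ := ih _ hb b.2 ⟨n, a⟩ d c.proj hab.symm hd hac.proj hcz.symm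
    obtain rfl := unique hG hc₁ hac hc₃
    exact ⟨d, hd, hc₂.symm, rfl⟩
  have hswap : (∃ d, (graph G v₀).Adj c d ∧ (graph G v₀).Adj b d ∧ d.proj = z) →
      ∃ d, (graph G v₀).Adj b d ∧ (graph G v₀).Adj c d ∧ d.proj = z :=
    fun ⟨d, h₁, h₂, h₃⟩ => ⟨d, h₂, h₁, h₃⟩
  cases hab with
  | up hb =>
    cases hac with
    | up hc => exact exists_square_of_up_up hG hb hc hbz hcz haz haz'
    | down hc =>
      exact hswap (hdown _ _ (.down hc) (.up hb) hcz hbz (Nat.lt_succ_self _))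
    | beside hc => exact exists_square_of_up_beside hG (ih _ (Nat.lt_succ_self _)) hb hc hbz hcz haz'
  | down hb => exact hdown _ _ (.down hb) hac hbz hcz (Nat.lt_succ_self _)
  | beside hb =>
    cases hac with
    | up hc =>
      exact hswap (exists_square_of_up_beside hG (ih _ (Nat.lt_succ_self _)) hc hb hcz hbz haz')
    | down hc => exact hswap (hdown _ _ (.down hc) (.beside hb) hcz hbz (Nat.lt_succ_self _))
    | beside hc => exact exists_square_of_beside_beside hG ih hb hc hbc hbz hcz

theorem isCellCovering (hG : IsLocallyWeaklyModular G) :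
    IsCellCovering (graph G v₀) G proj where
  map_adj h := h.proj
  exists_lift := exists_lift hG
  unique := unique hG
  triangle := triangle hG
  square {a} _ _ _ h₁ h₂ h₃ h₄ := squareLift hG _ a.2 _ _ _ h₁ h₂ h₃ h₄

variable (G v₀) in
/-- The base vertex of the unfolding. -/
def base : Unfolding G v₀ := ⟨0, PUnit.unit⟩

theorem level_le_of_adj {a b : Unfolding G v₀} (h : (graph G v₀).Adj a b) :
    b.level ≤ a.level + 1 := by
  cases h with
  | up => exact le_rfl
  | down => exact Nat.le_add_right _ 2
  | beside => exact Nat.le_succ _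

theorem exists_below_of_adj {a b : Unfolding G v₀} (h : (graph G v₀).Adj a b)
    (hl : a.level = b.level) :
    ∃ c, (graph G v₀).Adj c a ∧ (graph G v₀).Adj c b ∧ c.level + 1 = a.level := by
  cases h with
  | @up n => exact absurd hl (Nat.succ_ne_self n).symm
  | @down n => exact absurd hl (Nat.succ_ne_self n)
  | beside h =>
    obtain ⟨-, u, hu, hu'⟩ := h
    exact ⟨⟨_, u⟩, .up hu, .up hu', rfl⟩

/-- The quadrangle condition at the base, with layers for distances; it is the gluing statement of
`Layer.joined_and_interpolate`. -/
theorem exists_below_of_adj_adj (hG : IsLocallyWeaklyModular G) {a b c : Unfolding G v₀}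
    (h : (graph G v₀).Adj a c) (h' : (graph G v₀).Adj b c) (hl : a.level + 1 = c.level)
    (hl' : b.level + 1 = c.level) (hne : a ≠ b) :
    ∃ d, (graph G v₀).Adj d a ∧ (graph G v₀).Adj d b ∧ d.level + 1 = a.level := by
  cases h with
  | @up n _ a h =>
    cases h' with
    | @up _ _ b h' =>
      obtain _ | n := n
      · exact (hne (by rw [eq_of_zero a b])).elim
      rcases h.joined_of_above hG h' with rfl | ⟨u, hu, hu'⟩
      · exact (hne rfl).elim
      · exact ⟨⟨_, u⟩, .up hu, .up hu', rfl⟩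
    | @down n => simp [level] at hl'; omega
    | beside h => simp [level] at hl'
  | @down n => simp [level] at hl; omega
  | beside h => simp [level] at hl

theorem exists_adj_of_level {a : Unfolding G v₀} {n : ℕ} (h : a.level = n + 1) :
    ∃ b, (graph G v₀).Adj a b ∧ b.level = n := by
  obtain ⟨m, a⟩ := a
  obtain rfl : m = n + 1 := h
  obtain ⟨t, ht⟩ := a.exists_above
  exact ⟨⟨n, t⟩, .down ht, rfl⟩

theorem eq_base_of_level {a : Unfolding G v₀} (h : a.level = 0) : a = base G v₀ := by
  obtain ⟨m, a⟩ := a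
  obtain rfl : m = 0 := h
  rfl

end Unfolding

end Unfolding


/-! ### Composition of coverings, and lifting the local conditions -/

section Transfer

variable {V W U : Type*} {H : SimpleGraph W} {G : SimpleGraph V} {f : W → V}

theorem IsCellCovering.comp {K : SimpleGraph U} {g : U → W} (hf : IsCellCovering H G f)
    (hg : IsCellCovering K H g) : IsCellCovering K G (f ∘ g) where
  map_adj h := hf.map_adj (hg.map_adj h)
  exists_lift h := by
    obtain ⟨b, hb, rfl⟩ := hf.exists_lift h
    obtain ⟨c, hc, rfl⟩ := hg.exists_lift hb
    exact ⟨c, hc, rfl⟩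
  unique hb hc h := hg.unique hb hc (hf.unique (hg.map_adj hb) (hg.map_adj hc) h)
  triangle hb hc h := hg.triangle hb hc (hf.triangle (hg.map_adj hb) (hg.map_adj hc) h)
  square hb hc hbz hcz := by
    obtain ⟨d, hd, hd', rfl⟩ := hf.square (hg.map_adj hb) (hg.map_adj hc) hbz hcz
    obtain ⟨e, he, he', rfl⟩ := hg.square hb hc hd hd'
    exact ⟨e, he, he', rfl⟩

theorem IsCellCovering.ne_of_adj (hf : IsCellCovering H G f) {a b c : W} (hab : H.Adj a b)
    (hbc : H.Adj b c) (hac : a ≠ c) : f a ≠ f c :=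
  fun h => hac (hf.unique hab.symm hbc h)

/-- Together with `IsCellCovering.ne_of_adj`: a covering keeps vertices at distance two at distance
two, since a triangle in the image would lift. -/
theorem IsCellCovering.not_adj (hf : IsCellCovering H G f) {a b c : W} (hab : H.Adj a b)
    (hbc : H.Adj b c) (hac : ¬ H.Adj a c) : ¬ G.Adj (f a) (f c) :=
  fun h => hac (hf.triangle hab.symm hbc h)

/-- Two lifts of the two halves of a diagram with a common vertex agree. -/
theorem IsCellCovering.exists_common (hf : IsCellCovering H G f) {u a b v w : W} {x : V}
    (hua : H.Adj u a) (hav : H.Adj a v) (hub : H.Adj u b) (hbw : H.Adj b w)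
    (hux : G.Adj (f u) x) (hxv : G.Adj x (f v)) (hxw : G.Adj x (f w)) :
    ∃ y, H.Adj y u ∧ H.Adj y v ∧ H.Adj y w ∧ f y = x := by
  obtain ⟨y, hy, hy', rfl⟩ := hf.square hua.symm hav hux hxv.symm
  obtain ⟨y', hy₁, hy₁', h⟩ := hf.square hub.symm hbw hux hxw.symm
  obtain rfl := hf.unique hy hy₁ h.symm
  exact ⟨y, hy.symm, hy'.symm, hy₁'.symm, rfl⟩

/-- The configurations project to configurations with the same distances, and the common neighbour
found in `G` lifts through the 4-cycles it spans. -/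
theorem IsCellCovering.isLocallyWeaklyModular (hf : IsCellCovering H G f)
    (hG : IsLocallyWeaklyModular G) : IsLocallyWeaklyModular H := by
  intro u
  constructor
  · intro v w hvw huv huw
    obtain ⟨hne, hna, a, hua, hav⟩ := exists_of_dist_eq_two huv
    obtain ⟨hne', hna', b, hub, hbw⟩ := exists_of_dist_eq_two huw
    obtain ⟨x, hx₁, hx₂, hx₃⟩ := hG.exists_triangle (hf.map_adj hvw) (hf.map_adj hua)
      (hf.map_adj hav) (hf.map_adj hub) (hf.map_adj hbw) (hf.ne_of_adj hua hav hne)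
      (hf.not_adj hua hav hna) (hf.ne_of_adj hub hbw hne') (hf.not_adj hub hbw hna')
    obtain ⟨y, h₁, h₂, h₃, -⟩ := hf.exists_common hua hav hub hbw hx₁ hx₂ hx₃
    exact ⟨y, h₁, h₂, h₃⟩
  · intro v w z hzv hzw hvw huv huw huz
    obtain ⟨hne, hna, a, hua, hav⟩ := exists_of_dist_eq_two huv
    obtain ⟨hne', hna', b, hub, hbw⟩ := exists_of_dist_eq_two huw
    have hvw' : v ≠ w := (exists_of_dist_eq_two hvw).1
    have hfar := far_of_dist_eq_three huz
    have hnuz : ¬ G.Adj (f u) (f z) := fun h => by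
      obtain ⟨d, hd, hd', h'⟩ := hf.square hua.symm hav h (hf.map_adj hzv.symm)
      obtain rfl := hf.unique hd' hzv.symm h'
      exact hfar.2.1 hd
    have huz' : f u ≠ f z := fun h => hf.not_adj hua hav hna (h ▸ hf.map_adj hzv)
    -- Distance three also survives: a common neighbour of `f u` and `f z` could be chosen adjacent
    -- to `f v` by the local triangle condition, and would then lift to a common neighbour of `u`
    -- and `z`.
    have hfar' : Far G (f u) (f z) := by
      refine ⟨huz', hnuz, fun y hy hy' => ?_⟩
      obtain ⟨x, hx₁, hx₂, hx₃⟩ := hG.exists_triangle (hf.map_adj hzv.symm) (hf.map_adj hua)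
        (hf.map_adj hav) hy hy' (hf.ne_of_adj hua hav hne) (hf.not_adj hua hav hna) huz' hnuz
      obtain ⟨d, hd, hd', rfl⟩ := hf.square hua.symm hav hx₁ hx₂.symm
      exact hfar.2.2 d hd (hf.triangle hd' hzv.symm hx₃)
    obtain ⟨x, hx₁, hx₂, hx₃⟩ := hG.exists_of_far (hf.map_adj hzv.symm) (hf.map_adj hzw.symm)
      (hf.ne_of_adj hzv.symm hzw hvw') (hf.map_adj hua) (hf.map_adj hav) (hf.map_adj hub)
      (hf.map_adj hbw) hfar'
    obtain ⟨y, h₁, h₂, h₃, -⟩ := hf.exists_common hua hav hub hbw hx₁ hx₂ hx₃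
    exact ⟨y, h₁, h₂, h₃⟩

theorem IsCellCovering.surjective (hf : IsCellCovering H G f) (hG : G.Connected) (w : W) :
    Function.Surjective f := by
  intro v
  obtain ⟨p⟩ := hG.preconnected (f w) v
  have : ∀ a b : V, G.Walk a b → ∀ w, f w = a → ∃ w', f w' = b := by
    intro a b p
    induction p with
    | nil => exact fun w h => ⟨w, h⟩
    | cons h p ih =>
      rintro w rfl
      obtain ⟨w', -, hw'⟩ := hf.exists_lift h
      exact ih w' hw'
  exact this _ _ p w rfl

end Transfer

/-! ### Coordinates on cells and rescaling by weights -/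

section Topology

open Topology

variable {V : Type u} {G : SimpleGraph V}

instance : ContractibleSpace unitInterval :=
  (convex_Icc (0 : ℝ) 1).contractibleSpace ⟨0, by simp⟩

instance : ContractibleSpace (stdSimplex ℝ (Fin 3)) :=
  (convex_stdSimplex ℝ (Fin 3)).contractibleSpace ⟨_, single_mem_stdSimplex ℝ 0⟩

instance Cell.instCompactSpaceModel (K : Cell G) : CompactSpace K.Model :=
  match K with
  | .vertex _ => inferInstanceAs (CompactSpace Unit)
  | .edge _ _ _ => inferInstanceAs (CompactSpace unitInterval)
  | .triangle _ _ _ _ => inferInstanceAs (CompactSpace (stdSimplex ℝ (Fin 3)))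
  | .square _ _ _ _ _ => inferInstanceAs (CompactSpace (unitInterval × unitInterval))

instance Cell.instContractibleSpaceModel (K : Cell G) : ContractibleSpace K.Model :=
  match K with
  | .vertex _ => inferInstanceAs (ContractibleSpace Unit)
  | .edge _ _ _ => inferInstanceAs (ContractibleSpace unitInterval)
  | .triangle _ _ _ _ => inferInstanceAs (ContractibleSpace (stdSimplex ℝ (Fin 3)))
  | .square _ _ _ _ _ => inferInstanceAs (ContractibleSpace (unitInterval × unitInterval))

namespace Cell

/-- The set of vertices of a cell. -/
def verts : Cell G → Set V
  | .vertex v => {v}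
  | .edge a b _ => {a, b}
  | .triangle a b c _ => {a, b, c}
  | .square a b c d _ => {a, b, c, d}

theorem coords_edge {a b : V} (h : G.Adj a b) (t : unitInterval) :
    (Cell.edge a b h).coords t = Finsupp.single a (1 - (t : ℝ)) + Finsupp.single b (t : ℝ) := rfl

theorem coords_triangle {a b c : V} (h : IsTriangle G a b c) (y : stdSimplex ℝ (Fin 3)) :
    (Cell.triangle a b c h).coords y =
      Finsupp.single a (y.1 0) + Finsupp.single b (y.1 1) + Finsupp.single c (y.1 2) := rfl

theorem coords_square {a b c d : V} (h : IsInducedSquare G a b c d)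
    (y : unitInterval × unitInterval) :
    (Cell.square a b c d h).coords y =
      Finsupp.single a ((1 - (y.1 : ℝ)) * (1 - (y.2 : ℝ))) +
      Finsupp.single b ((y.1 : ℝ) * (1 - (y.2 : ℝ))) +
      Finsupp.single c ((y.1 : ℝ) * (y.2 : ℝ)) +
      Finsupp.single d ((1 - (y.1 : ℝ)) * (y.2 : ℝ)) := rfl

/-- Continuous linear functionals on the coordinates of a cell. -/
theorem continuous_map_coords (K : Cell G) {M : Type*} [TopologicalSpace M] [AddCommGroup M]
    [Module ℝ M] [ContinuousAdd M] [ContinuousSMul ℝ M] (L : (V →₀ ℝ) →ₗ[ℝ] M) :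
    Continuous fun y : K.Model => L (K.coords y) := by
  have key : ∀ (v : V) (r : ℝ), L (Finsupp.single v r) = r • L (Finsupp.single v 1) := by
    intro v r
    rw [← map_smul, Finsupp.smul_single, smul_eq_mul, mul_one]
  cases K with
  | vertex v =>
    change Continuous fun _ : Unit => L (Finsupp.single v 1)
    exact continuous_const
  | edge a b h =>
    have : (fun t : unitInterval => L ((Cell.edge a b h).coords t)) = fun t : unitInterval =>
        (1 - (t : ℝ)) • L (Finsupp.single a 1) + (t : ℝ) • L (Finsupp.single b 1) := by
      funext t
      rw [coords_edge, map_add, key a, key b]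
    change Continuous fun t : unitInterval => L ((Cell.edge a b h).coords t)
    rw [this]
    fun_prop
  | triangle a b c h =>
    have : (fun y : stdSimplex ℝ (Fin 3) => L ((Cell.triangle a b c h).coords y)) =
        fun y : stdSimplex ℝ (Fin 3) => y.1 0 • L (Finsupp.single a 1) +
          y.1 1 • L (Finsupp.single b 1) + y.1 2 • L (Finsupp.single c 1) := by
      funext y
      rw [coords_triangle, map_add, map_add, key a, key b, key c]
    change Continuous fun y : stdSimplex ℝ (Fin 3) => L ((Cell.triangle a b c h).coords y)
    rw [this]
    have hi : ∀ i, Continuous fun y : stdSimplex ℝ (Fin 3) => y.1 i := fun i =>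
      (continuous_apply i).comp continuous_subtype_val
    exact (((hi 0).smul continuous_const).add ((hi 1).smul continuous_const)).add
      ((hi 2).smul continuous_const)
  | square a b c d h =>
    have : (fun y : unitInterval × unitInterval => L ((Cell.square a b c d h).coords y)) =
        fun y : unitInterval × unitInterval =>
          ((1 - (y.1 : ℝ)) * (1 - (y.2 : ℝ))) • L (Finsupp.single a 1) +
          ((y.1 : ℝ) * (1 - (y.2 : ℝ))) • L (Finsupp.single b 1) +
          ((y.1 : ℝ) * (y.2 : ℝ)) • L (Finsupp.single c 1) +
          ((1 - (y.1 : ℝ)) * (y.2 : ℝ)) • L (Finsupp.single d 1) := by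
      funext y
      rw [coords_square, map_add, map_add, map_add, key a, key b, key c, key d]
    change Continuous fun y : unitInterval × unitInterval => L ((Cell.square a b c d h).coords y)
    rw [this]
    fun_prop

theorem continuous_coords_apply (K : Cell G) (w : V) :
    Continuous fun y : K.Model => K.coords y w :=
  K.continuous_map_coords (Finsupp.lapply w)

theorem coords_nonneg (K : Cell G) (y : K.Model) (w : V) : 0 ≤ K.coords y w := by
  have key : ∀ (v : V) (r : ℝ), 0 ≤ r → 0 ≤ Finsupp.single v r w := by
    intro v r hr
    classical
    rw [Finsupp.single_apply]
    split_ifs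
    exacts [hr, le_rfl]
  cases K with
  | vertex v => exact key _ _ zero_le_one
  | edge a b h =>
    rw [coords_edge h y]
    exact add_nonneg (key _ _ (sub_nonneg.2 y.2.2)) (key _ _ y.2.1)
  | triangle a b c h =>
    rw [coords_triangle h y]
    exact add_nonneg (add_nonneg (key _ _ (y.2.1 _)) (key _ _ (y.2.1 _))) (key _ _ (y.2.1 _))
  | square a b c d h =>
    rw [coords_square h y]
    have h1 := y.1.2.1
    have h2 := y.2.2.1
    have h3 := sub_nonneg.2 y.1.2.2
    have h4 := sub_nonneg.2 y.2.2.2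
    refine add_nonneg (add_nonneg (add_nonneg ?_ ?_) ?_) ?_ <;>
      exact key _ _ (mul_nonneg (by assumption) (by assumption))

theorem mem_verts_of_coords_ne_zero (K : Cell G) (y : K.Model) {w : V} (h : K.coords y w ≠ 0) :
    w ∈ K.verts := by
  contrapose! h
  cases K with
  | vertex v =>
    exact Finsupp.single_eq_of_ne h
  | edge a b h' =>
    simp only [verts, Set.mem_insert_iff, Set.mem_singleton_iff, not_or] at h
    rw [coords_edge h' y]
    simp [h]
  | triangle a b c h' =>
    simp only [verts, Set.mem_insert_iff, Set.mem_singleton_iff, not_or] at h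
    rw [coords_triangle h' y]
    simp [h]
  | square a b c d h' =>
    simp only [verts, Set.mem_insert_iff, Set.mem_singleton_iff, not_or] at h
    rw [coords_square h' y]
    simp [h]

theorem coords_injective (K : Cell G) : Function.Injective K.coords := by
  cases K with
  | vertex v => exact fun _ _ _ => rfl
  | edge a b h =>
    intro (y : unitInterval) (y' : unitInterval) hy
    have := DFunLike.congr_fun hy b
    simp only [coords_edge] at this
    simp [h.ne] at this
    exact Subtype.ext this
  | triangle a b c h =>
    intro (y : stdSimplex ℝ (Fin 3)) (y' : stdSimplex ℝ (Fin 3)) hy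
    have ha := DFunLike.congr_fun hy a
    have hb := DFunLike.congr_fun hy b
    have hc := DFunLike.congr_fun hy c
    simp only [coords_triangle] at ha hb hc
    simp [h.1.ne, h.2.1.ne, h.2.2.ne, h.1.ne', h.2.1.ne', h.2.2.ne'] at ha hb hc
    refine Subtype.ext (funext fun i => ?_)
    fin_cases i
    exacts [ha, hb, hc]
  | square a b c d h =>
    intro (y : unitInterval × unitInterval) (y' : unitInterval × unitInterval) hy
    have hb := DFunLike.congr_fun hy b
    have hc := DFunLike.congr_fun hy c
    have hd := DFunLike.congr_fun hy d
    obtain ⟨⟨h₁, h₂, h₃, h₄⟩, ⟨h₅, -⟩, ⟨h₆, -⟩⟩ := id h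
    simp only [coords_square] at hb hc hd
    simp [h₂.ne, h₃.ne, h₄.ne, h₆, h₁.ne', h₂.ne', h₃.ne', h₅.symm,
      h₆.symm] at hb hc hd
    refine Prod.ext (Subtype.ext ?_) (Subtype.ext ?_) <;> linarith

/-- An injective continuous map from a compact space to a Hausdorff space. Continuity of maps into a
cell can thus be checked on coordinates. -/
theorem isInducing_coords (K : Cell G) :
    IsInducing fun (y : K.Model) (w : V) => K.coords y w := by
  refine (Continuous.isClosedEmbedding ?_ ?_).isInducing
  · exact continuous_pi fun w => K.continuous_coords_apply w
  · exact fun y y' h => K.coords_injective (Finsupp.ext fun w => congrFun h w)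

/-- Weights on the vertices of a cell that rescale its points to points of the cell. -/
def Compatible (κ : V → ℝ) : Cell G → Prop
  | .square a b c d _ => κ a * κ c = κ b * κ d
  | _ => True

/-- The coordinates multiplied by weights. -/
noncomputable def weigh (κ : V → ℝ) : (V →₀ ℝ) →ₗ[ℝ] (V →₀ ℝ) :=
  Finsupp.linearCombination ℝ fun w => Finsupp.single w (κ w)

/-- The sum of the coordinates multiplied by weights. -/
noncomputable def total (κ : V → ℝ) : (V →₀ ℝ) →ₗ[ℝ] ℝ := Finsupp.linearCombination ℝ κ

theorem weigh_single (κ : V → ℝ) (v : V) (r : ℝ) :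
    weigh κ (Finsupp.single v r) = Finsupp.single v (r * κ v) := by
  simp [weigh]

theorem weigh_apply (κ : V → ℝ) (x : V →₀ ℝ) (w : V) : weigh κ x w = κ w * x w := by
  classical
  induction x using Finsupp.induction_linear with
  | zero => simp
  | add f g hf hg => simp [hf, hg, mul_add]
  | single v r =>
    rw [weigh_single, Finsupp.single_apply, Finsupp.single_apply]
    split_ifs with h
    · rw [h, mul_comm]
    · simp

theorem total_single (κ : V → ℝ) (v : V) (r : ℝ) :
    total κ (Finsupp.single v r) = r * κ v := by
  simp [total]

theorem total_coords (K : Cell G) (y : K.Model) : total (fun _ => 1) (K.coords y) = 1 := by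
  cases K with
  | vertex v =>
    change total _ (Finsupp.single v 1) = 1
    simp [total_single]
  | edge a b h =>
    rw [coords_edge h y]
    simp [total_single]
  | triangle a b c h =>
    have h2 := y.2.2
    rw [coords_triangle h y]
    rw [Fin.sum_univ_three] at h2
    simpa [total_single] using h2
  | square a b c d h =>
    rw [coords_square h y]
    simp only [map_add, total_single]
    ring

/-- For simplices any weights with positive total will do. Four nonnegative numbers `p, q, r, s` of
sum one are the coordinates of a point of the square exactly if `p * r = q * s`, and compatible
weights preserve this equation. -/
theorem exists_coords_eq_rescale (K : Cell G) (κ : V → ℝ) (hκ : ∀ w, 0 ≤ κ w)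
    (hK : K.Compatible κ) (y : K.Model) (hy : 0 < total κ (K.coords y)) :
    ∃ y' : K.Model, K.coords y' = (total κ (K.coords y))⁻¹ • weigh κ (K.coords y) := by
  cases K with
  | vertex v =>
    refine ⟨y, ?_⟩
    change Finsupp.single v 1 = _
    change 0 < total κ (Finsupp.single v 1) at hy
    change _ = (total κ (Finsupp.single v 1))⁻¹ • weigh κ (Finsupp.single v 1)
    rw [total_single] at *
    rw [weigh_single, Finsupp.smul_single, smul_eq_mul, inv_mul_cancel₀ hy.ne']
  | edge a b h =>
    change unitInterval at y
    rw [coords_edge] at hy ⊢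
    simp only [map_add, total_single, weigh_single] at hy ⊢
    set N := (1 - (y : ℝ)) * κ a + y * κ b with hN
    have h1 := mul_nonneg (sub_nonneg.2 y.2.2) (hκ a)
    have h2 := mul_nonneg y.2.1 (hκ b)
    refine ⟨(⟨y * κ b / N, div_nonneg h2 hy.le, (div_le_one hy).2 (by linarith)⟩ : unitInterval), ?_⟩
    rw [coords_edge]
    simp only [smul_add, Finsupp.smul_single, smul_eq_mul]
    congr 2
    · field_simp
      linarith
    · field_simp
  | triangle a b c h =>
    change stdSimplex ℝ (Fin 3) at y
    rw [coords_triangle] at hy ⊢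
    simp only [map_add, total_single, weigh_single] at hy ⊢
    set N := y.1 0 * κ a + y.1 1 * κ b + y.1 2 * κ c with hN
    have h0 := mul_nonneg (y.2.1 0) (hκ a)
    have h1 := mul_nonneg (y.2.1 1) (hκ b)
    have h2 := mul_nonneg (y.2.1 2) (hκ c)
    refine ⟨(⟨![N⁻¹ * (y.1 0 * κ a), N⁻¹ * (y.1 1 * κ b), N⁻¹ * (y.1 2 * κ c)], ?_, ?_⟩ :
      stdSimplex ℝ (Fin 3)), ?_⟩
    · intro i
      fin_cases i
      · exact mul_nonneg (inv_nonneg.2 hy.le) h0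
      · exact mul_nonneg (inv_nonneg.2 hy.le) h1
      · exact mul_nonneg (inv_nonneg.2 hy.le) h2
    · rw [Fin.sum_univ_three]
      simp only [Matrix.cons_val]
      rw [← mul_add, ← mul_add, inv_mul_cancel₀ hy.ne']
    · rw [coords_triangle]
      simp only [smul_add, Finsupp.smul_single, smul_eq_mul, Matrix.cons_val]
  | square a b c d h =>
    change unitInterval × unitInterval at y
    rw [coords_square] at hy ⊢
    simp only [map_add, total_single, weigh_single] at hy ⊢
    have h1 := y.1.2.1
    have h2 := y.2.2.1
    have h3 := sub_nonneg.2 y.1.2.2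
    have h4 := sub_nonneg.2 y.2.2.2
    replace hK : κ a * κ c = κ b * κ d := hK
    have hpr : (1 - (y.1 : ℝ)) * (1 - (y.2 : ℝ)) * κ a * ((y.1 : ℝ) * (y.2 : ℝ) * κ c) =
      (y.1 : ℝ) * (1 - (y.2 : ℝ)) * κ b * ((1 - (y.1 : ℝ)) * (y.2 : ℝ) * κ d) := by
      linear_combination ((1 - (y.1 : ℝ)) * (1 - (y.2 : ℝ)) * ((y.1 : ℝ) * (y.2 : ℝ))) * hK
    have hp := mul_nonneg (mul_nonneg h3 h4) (hκ a)
    have hq := mul_nonneg (mul_nonneg h1 h4) (hκ b)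
    have hr := mul_nonneg (mul_nonneg h1 h2) (hκ c)
    have hs := mul_nonneg (mul_nonneg h3 h2) (hκ d)
    generalize (1 - (y.1 : ℝ)) * (1 - (y.2 : ℝ)) * κ a = p at *
    generalize (y.1 : ℝ) * (1 - (y.2 : ℝ)) * κ b = q at *
    generalize (y.1 : ℝ) * (y.2 : ℝ) * κ c = r at *
    generalize (1 - (y.1 : ℝ)) * (y.2 : ℝ) * κ d = s at *
    -- The two coordinates of the new point are the marginals of the normalized weights; `hpr` says
    -- that the weights are the products of their marginals.
    refine ⟨((⟨(q + r) / (p + q + r + s), div_nonneg (add_nonneg hq hr) hy.le,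
      (div_le_one hy).2 (by linarith)⟩, ⟨(r + s) / (p + q + r + s),
      div_nonneg (add_nonneg hr hs) hy.le, (div_le_one hy).2 (by linarith)⟩) :
      unitInterval × unitInterval), ?_⟩
    rw [coords_square]
    simp only [smul_add, Finsupp.smul_single, smul_eq_mul]
    have e1 : (1 - (q + r) / (p + q + r + s)) = (p + s) / (p + q + r + s) := by
      field_simp; ring
    have e2 : (1 - (r + s) / (p + q + r + s)) = (p + q) / (p + q + r + s) := by
      field_simp; ring
    rw [e1, e2]
    have e3 : (p + s) / (p + q + r + s) * ((p + q) / (p + q + r + s)) =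
        (p + q + r + s)⁻¹ * p := by
      field_simp
      linear_combination -hpr
    have e4 : (q + r) / (p + q + r + s) * ((p + q) / (p + q + r + s)) =
        (p + q + r + s)⁻¹ * q := by
      field_simp
      linear_combination hpr
    have e5 : (q + r) / (p + q + r + s) * ((r + s) / (p + q + r + s)) =
        (p + q + r + s)⁻¹ * r := by
      field_simp
      linear_combination -hpr
    have e6 : (p + s) / (p + q + r + s) * ((r + s) / (p + q + r + s)) =
        (p + q + r + s)⁻¹ * s := by
      field_simp
      linear_combination hpr
    rw [e3, e4, e5, e6]

end Cell

end Topology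


/-! ### Subdividing paths along an open cover -/

section PathClasses

open Topology

/-- A property of path classes that is closed under concatenation and holds for paths in the
members of an open cover holds for all paths. -/
theorem path_class_induction {X : Type*} [TopologicalSpace X] {ι : Type*} {U : ι → Set X}
    (hU : ∀ i, IsOpen (U i)) (hU' : ∀ x, ∃ i, x ∈ U i)
    {P : ∀ {x y : X}, Path.Homotopic.Quotient x y → Prop}
    (trans : ∀ {x y z : X} (p : Path.Homotopic.Quotient x y) (q : Path.Homotopic.Quotient y z),
      P p → P q → P (p.trans q))
    (small : ∀ (i : ι) {x y : X} (γ : Path x y), (∀ t, γ t ∈ U i) →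
      P (Path.Homotopic.Quotient.mk γ)) {x y : X} (q : Path.Homotopic.Quotient x y) : P q := by
  obtain ⟨γ, rfl⟩ := Path.Homotopic.Quotient.mk_surjective q
  obtain ⟨t, ht0, htm, ⟨n, hn⟩, ht⟩ := exists_monotone_Icc_subset_open_cover_unitInterval
    (c := fun i => γ ⁻¹' U i) (fun i => (hU i).preimage γ.continuous) (fun s _ => by
      obtain ⟨i, hi⟩ := hU' (γ s)
      exact Set.mem_iUnion.2 ⟨i, hi⟩)
  have step : ∀ m, P (Path.Homotopic.Quotient.mk (γ.subpath (t m) (t (m + 1)))) := by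
    intro m
    obtain ⟨i, hi⟩ := ht m
    refine small i _ fun s => ?_
    have : γ.subpath (t m) (t (m + 1)) s ∈ Set.range (γ.subpath (t m) (t (m + 1))) := ⟨s, rfl⟩
    rw [γ.range_subpath_of_le _ _ (htm (Nat.le_succ m))] at this
    obtain ⟨s', hs', h⟩ := this
    rw [← h]
    exact hi hs'
  have key : ∀ m, P (Path.Homotopic.Quotient.mk (γ.subpath (t 0) (t (m + 1)))) := by
    intro m
    induction m with
    | zero => exact step 0
    | succ m ih =>
      have := trans _ _ ih (step (m + 1))
      rw [← Path.Homotopic.Quotient.mk_trans,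
        Path.Homotopic.Quotient.eq.2 ⟨Path.Homotopy.subpathTransSubpath γ _ _ _⟩] at this
      exact this
  have h := key n
  rw [ht0, hn (n + 1) (Nat.le_succ n), Path.subpath_zero_one] at h
  obtain ⟨γ, rfl, rfl⟩ := γ
  exact h

end PathClasses

/-! ### Open stars and their radial contraction -/

section Complex

open Topology

variable {V : Type u} {G : SimpleGraph V}

theorem continuous_charMap (K : Cell G) : Continuous K.charMap :=
  continuous_iff_coinduced_le.2 (le_iSup (fun K : Cell G =>
    TopologicalSpace.coinduced K.charMap inferInstance) K)

theorem isOpen_complex_iff {s : Set (TriangleSquareComplex G)} :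
    IsOpen s ↔ ∀ K : Cell G, IsOpen (K.charMap ⁻¹' s) := by
  refine isOpen_iSup_iff.trans (forall_congr' fun K => ?_)
  exact isOpen_coinduced

theorem charMap_injective (K : Cell G) : Function.Injective K.charMap := fun _ _ h =>
  K.coords_injective (congrArg Subtype.val h)

theorem exists_charMap_eq (x : TriangleSquareComplex G) :
    ∃ (K : Cell G) (y : K.Model), K.charMap y = x := by
  obtain ⟨x, K, y, rfl⟩ := x
  exact ⟨K, y, rfl⟩

/-- An open subset of the complex again has the weak topology of its intersections with the closed
cells. -/
theorem continuous_of_charMap {U : Set (TriangleSquareComplex G)} (hU : IsOpen U) {Z : Type*}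
    [TopologicalSpace Z] {f : U → Z}
    (h : ∀ K : Cell G, Continuous fun y : K.charMap ⁻¹' U => f ⟨K.charMap y, y.2⟩) :
    Continuous f := by
  refine continuous_def.2 fun s hs => ?_
  rw [hU.isOpenEmbedding_subtypeVal.isOpen_iff_image_isOpen, isOpen_complex_iff]
  intro K
  have h' := ((hU.preimage (continuous_charMap K)).isOpenEmbedding_subtypeVal.isOpen_iff_image_isOpen
    ).1 (hs.preimage (h K))
  convert! h' using 1
  ext y
  simp

variable (G) in
/-- The open star of a vertex. -/
def openStar (v : V) : Set (TriangleSquareComplex G) := {x | x.1 v ≠ 0}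

theorem isOpen_openStar (v : V) : IsOpen (openStar G v) :=
  isOpen_complex_iff.2 fun K => isOpen_ne.preimage (K.continuous_coords_apply v)

theorem exists_mem_openStar (x : TriangleSquareComplex G) : ∃ v, x ∈ openStar G v := by
  by_contra! h
  obtain ⟨K, y, rfl⟩ := exists_charMap_eq x
  have h0 : K.coords y = 0 := Finsupp.ext fun v => not_not.1 (h v)
  have h1 := K.total_coords y
  rw [h0, map_zero] at h1
  exact zero_ne_one h1

/-- The distance from `v`, cut off at two. -/
noncomputable def cutDist (G : SimpleGraph V) (v w : V) : ℕ :=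
  open Classical in if w = v then 0 else if G.Adj v w then 1 else 2

/-- The weights that contract the open star of `v`. -/
noncomputable def starWeight (G : SimpleGraph V) (v : V) (l : ℝ) (w : V) : ℝ :=
  l ^ cutDist G v w

theorem cutDist_self (v : V) : cutDist G v v = 0 := by simp [cutDist]

theorem cutDist_of_adj {v w : V} (h : G.Adj v w) : cutDist G v w = 1 := by
  simp [cutDist, h, h.ne']

theorem cutDist_of_not_adj {v w : V} (hne : v ≠ w) (h : ¬ G.Adj v w) : cutDist G v w = 2 := by
  simp [cutDist, h, hne.symm]

/-- Around a square starting from its corner `v` the weights are `1, l, l ^ 2, l`. The exponent two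
at the opposite corner requires the 4-cycle to be induced. -/
theorem compatible_starWeight {v : V} {K : Cell G} (h : v ∈ K.verts) (l : ℝ) :
    K.Compatible (starWeight G v l) := by
  cases K with
  | vertex => trivial
  | edge => trivial
  | triangle => trivial
  | square a b c d hs =>
    change starWeight G v l a * starWeight G v l c = starWeight G v l b * starWeight G v l d
    obtain ⟨⟨h₁, h₂, h₃, h₄⟩, ⟨h₅, h₆⟩, ⟨h₇, h₈⟩⟩ := hs
    simp only [Cell.verts, Set.mem_insert_iff, Set.mem_singleton_iff] at h
    rcases h with rfl | rfl | rfl | rfl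
    · simp [starWeight, cutDist_self, cutDist_of_adj h₁, cutDist_of_adj h₄.symm,
        cutDist_of_not_adj h₅ h₆]
      ring
    · simp [starWeight, cutDist_self, cutDist_of_adj h₂, cutDist_of_adj h₁.symm,
        cutDist_of_not_adj h₇ h₈]
      ring
    · simp [starWeight, cutDist_self, cutDist_of_adj h₃, cutDist_of_adj h₂.symm,
        cutDist_of_not_adj h₅.symm fun h => h₆ h.symm]
      ring
    · simp [starWeight, cutDist_self, cutDist_of_adj h₄, cutDist_of_adj h₃.symm,
        cutDist_of_not_adj h₇.symm fun h => h₈ h.symm]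
      ring

theorem total_starWeight_pos {v : V} {K : Cell G} {y : K.Model} (h : K.coords y v ≠ 0) {l : ℝ}
    (hl : 0 ≤ l) : 0 < Cell.total (starWeight G v l) (K.coords y) := by
  have h0 : 0 < K.coords y v := lt_of_le_of_ne (K.coords_nonneg y v) h.symm
  refine h0.trans_le ?_
  rw [Cell.total, Finsupp.linearCombination_apply, Finsupp.sum]
  have := Finset.single_le_sum (f := fun w => K.coords y w • starWeight G v l w)
    (s := (K.coords y).support)
    (fun w _ => mul_nonneg (K.coords_nonneg y w) (pow_nonneg hl _))
    (Finsupp.mem_support_iff.2 h)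
  simpa [starWeight, cutDist_self] using this

theorem exists_contract {v : V} (K : Cell G) (y : K.Model) (h : K.coords y v ≠ 0)
    (l : unitInterval) : ∃ y' : K.Model, K.coords y' =
      (Cell.total (starWeight G v l) (K.coords y))⁻¹ •
        Cell.weigh (starWeight G v l) (K.coords y) :=
  K.exists_coords_eq_rescale _ (fun _ => pow_nonneg l.2.1 _)
    (compatible_starWeight (K.mem_verts_of_coords_ne_zero y h) _) y (total_starWeight_pos h l.2.1)

/-- The contraction of the open star of `v`. -/
noncomputable def contract (v : V) (x : openStar G v) (l : unitInterval) :
    TriangleSquareComplex G :=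
  ⟨(Cell.total (starWeight G v l) x.1.1)⁻¹ • Cell.weigh (starWeight G v l) x.1.1, by
    obtain ⟨⟨x, K, y, rfl⟩, h⟩ := x
    exact ⟨K, exists_contract K y h l⟩⟩

/-- The contraction moves each point inside any closed cell that contains it, so it can be studied
on one cell at a time. -/
theorem exists_continuous_contract (v : V) (K : Cell G) :
    ∃ m : (K.charMap ⁻¹' openStar G v) × unitInterval → K.Model, Continuous m ∧
      ∀ p, K.charMap (m p) = contract v ⟨K.charMap p.1, p.1.2⟩ p.2 := by
  choose m hm using fun p : (K.charMap ⁻¹' openStar G v) × unitInterval =>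
    exists_contract (v := v) K p.1.1 p.1.2 p.2
  refine ⟨m, K.isInducing_coords.continuous_iff.2 (continuous_pi fun w => ?_),
    fun p => Subtype.ext (hm p)⟩
  change Continuous fun p => K.coords (m p) w
  simp only [hm, Finsupp.smul_apply, Cell.weigh_apply, smul_eq_mul]
  have hpow : ∀ w : V, Continuous fun p : (K.charMap ⁻¹' openStar G v) × unitInterval =>
      starWeight G v p.2 w := fun w => by
    unfold starWeight
    fun_prop
  have hpos : ∀ p : (K.charMap ⁻¹' openStar G v) × unitInterval,
      Cell.total (starWeight G v p.2) (K.coords p.1.1) ≠ 0 := fun p =>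
    (total_starWeight_pos p.1.2 p.2.2.1).ne'
  have htot : Continuous fun p : (K.charMap ⁻¹' openStar G v) × unitInterval =>
      Cell.total (starWeight G v p.2) (K.coords p.1.1) := by
    -- The total weight depends on `l`. Sorting the vertices by their cut-off distance makes it a
    -- polynomial in `l` whose coefficients are fixed linear functionals of the point.
    have : ∀ k : ℕ, Continuous fun y : K.Model =>
        Cell.total (fun w => if cutDist G v w = k then 1 else 0) (K.coords y) := fun k =>
      K.continuous_map_coords _
    have h : ∀ (l : ℝ) (x : V →₀ ℝ), Cell.total (starWeight G v l) x =
        ∑ k ∈ Finset.range 3,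
          l ^ k * Cell.total (fun w => if cutDist G v w = k then 1 else 0) x := by
      intro l x
      induction x using Finsupp.induction_linear with
      | zero => simp
      | add f g hf hg => simp only [map_add, hf, hg, mul_add, Finset.sum_add_distrib]
      | single w r =>
        have hw : cutDist G v w < 3 := by
          unfold cutDist
          split_ifs <;> norm_num
        simp only [Cell.total_single, starWeight]
        rw [Finset.sum_eq_single (cutDist G v w)]
        · simp [mul_comm]
        · intro k _ hk
          simp [hk.symm]
        · simp [hw]
    simp only [h]
    have h' : Continuous fun p : (K.charMap ⁻¹' openStar G v) × unitInterval => p.1.1 := by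
      fun_prop
    exact continuous_finsetSum _ fun k _ => ((continuous_subtype_val.comp continuous_snd).pow k).mul
      ((this k).comp h')
  refine (htot.inv₀ hpos).mul ((hpow w).mul ?_)
  exact (K.continuous_coords_apply w).comp (continuous_subtype_val.comp continuous_fst)

/-- Continuity on a product with the interval cannot be tested directly on the cells of the first
factor. The map is therefore curried into the space of paths, tested there on cells, and uncurried
using local compactness of the interval. -/
theorem continuous_contract (v : V) :
    Continuous fun p : openStar G v × unitInterval => contract v p.1 p.2 := by
  have h₁ : ∀ K : Cell G, Continuous fun p : (K.charMap ⁻¹' openStar G v) × unitInterval =>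
      contract v ⟨K.charMap p.1, p.1.2⟩ p.2 := by
    intro K
    obtain ⟨m, hm, h⟩ := exists_continuous_contract v K
    simp only [← h]
    exact (continuous_charMap K).comp hm
  have h₂ : ∀ x : openStar G v, Continuous (contract v x) := by
    rintro ⟨x, hx⟩
    obtain ⟨K, y, rfl⟩ := exists_charMap_eq x
    have h := (h₁ K).comp (Continuous.prodMk_right (⟨y, hx⟩ : K.charMap ⁻¹' openStar G v))
    exact h
  let F : openStar G v → C(unitInterval, TriangleSquareComplex G) := fun x => ⟨_, h₂ x⟩
  have hF : Continuous F := continuous_of_charMap (isOpen_openStar v) fun K => by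
    have h := (ContinuousMap.curry ⟨_, h₁ K⟩).continuous
    exact h
  exact ContinuousMap.continuous_uncurry_of_continuous ⟨F, hF⟩

theorem contract_one (v : V) (x : openStar G v) : contract v x 1 = x.1 := by
  apply Subtype.ext
  obtain ⟨⟨x, K, y, rfl⟩, h⟩ := x
  have hw : Cell.weigh (starWeight G v 1) (K.coords y) = K.coords y := by
    ext w
    simp [Cell.weigh_apply, starWeight]
  change (Cell.total (starWeight G v (1 : ℝ)) (K.coords y))⁻¹ •
    Cell.weigh (starWeight G v (1 : ℝ)) (K.coords y) = K.coords y
  rw [hw]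
  have : starWeight G v 1 = fun _ => 1 := by
    funext w
    simp [starWeight]
  rw [this, Cell.total_coords, inv_one, one_smul]

theorem contract_zero (v : V) (x : openStar G v) : contract v x 0 = vertexPoint G v := by
  apply Subtype.ext
  change (Cell.total (starWeight G v (0 : ℝ)) x.1.1)⁻¹ •
    Cell.weigh (starWeight G v (0 : ℝ)) x.1.1 = Finsupp.single v 1
  have h0 : ∀ w, w ≠ v → starWeight G v 0 w = 0 := by
    intro w hw
    unfold starWeight cutDist
    rw [if_neg hw]
    split_ifs <;> simp
  have hw : Cell.weigh (starWeight G v 0) x.1.1 = Finsupp.single v (x.1.1 v) := by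
    ext w
    rw [Cell.weigh_apply]
    by_cases h : w = v
    · subst h
      simp [starWeight, cutDist_self]
    · rw [h0 w h, Finsupp.single_eq_of_ne h, zero_mul]
  have ht : Cell.total (starWeight G v 0) x.1.1 = x.1.1 v := by
    rw [Cell.total, Finsupp.linearCombination_apply, Finsupp.sum,
      Finset.sum_eq_single v (fun w _ hw => by rw [h0 w hw, smul_zero])
        (fun h => by rw [Finsupp.notMem_support_iff.1 h, zero_smul])]
    simp [starWeight, cutDist_self]
  rw [hw, ht, Finsupp.smul_single, smul_eq_mul, inv_mul_cancel₀ x.2]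

attribute [irreducible] contract

/-- The contraction of the open star of `v`, as a homotopy. -/
noncomputable def contractHomotopy (v : V) :
    (⟨Subtype.val, continuous_subtype_val⟩ : C(openStar G v, TriangleSquareComplex G)).Homotopy
      (ContinuousMap.const _ (vertexPoint G v)) where
  toFun p := contract v p.2 (unitInterval.symm p.1)
  continuous_toFun := by
    have h := (continuous_contract (G := G) v).comp ((continuous_snd (X := unitInterval)).prodMk
      (unitInterval.continuous_symm.comp continuous_fst))
    exact h
  map_zero_left x := by simp [contract_one]
  map_one_left x := by simp [contract_zero]

/-- The path from a point of the open star of `v` to `v`. -/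
noncomputable def radialPath (v : V) (x : TriangleSquareComplex G) (h : x ∈ openStar G v) :
    Path x (vertexPoint G v) :=
  (contractHomotopy v).evalAt (⟨x, h⟩ : openStar G v)

theorem exists_path_radialPath (v : V) (K : Cell G) (y : K.Model)
    (h : K.charMap y ∈ openStar G v) : ∃ (y' : K.Model) (δ : Path y y'),
      ∀ t, K.charMap (δ t) = radialPath v _ h t := by
  obtain ⟨m, hm, hm'⟩ := exists_continuous_contract v K
  have hcont : Continuous fun t => m ((⟨y, h⟩ : K.charMap ⁻¹' openStar G v), unitInterval.symm t) :=
    hm.comp (continuous_const.prodMk unitInterval.continuous_symm)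
  refine ⟨_, ⟨⟨_, hcont⟩, charMap_injective K ?_, rfl⟩, fun t => ?_⟩
  swap
  · exact hm' (⟨y, h⟩, unitInterval.symm t)
  change K.charMap (m _) = _
  rw [hm', unitInterval.symm_zero, contract_one]

end Complex


/-! ### Cancellation of path classes -/

section Quotient

variable {X : Type*} [TopologicalSpace X] {x y z : X}

theorem trans_symm_cancel (p : Path.Homotopic.Quotient x y) (q : Path.Homotopic.Quotient x z) :
    p.trans (p.symm.trans q) = q := by
  rw [← Path.Homotopic.Quotient.trans_assoc, Path.Homotopic.Quotient.trans_symm,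
    Path.Homotopic.Quotient.refl_trans]

theorem symm_trans_cancel (p : Path.Homotopic.Quotient y x) (q : Path.Homotopic.Quotient x z) :
    p.symm.trans (p.trans q) = q := by
  rw [← Path.Homotopic.Quotient.trans_assoc, Path.Homotopic.Quotient.symm_trans,
    Path.Homotopic.Quotient.refl_trans]

end Quotient

/-! ### Every path between vertices is homotopic to an edge path -/

section EdgeClasses

open Topology

variable {V : Type u} {G : SimpleGraph V}

/-- An edge, as a path. -/
noncomputable def edgePath {a b : V} (h : G.Adj a b) : Path (vertexPoint G a) (vertexPoint G b) where
  toFun := edgePoint h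
  continuous_toFun := continuous_charMap (Cell.edge a b h)
  source' := edgePoint_zero h
  target' := edgePoint_one h

/-- The homotopy class of an edge. -/
noncomputable def edgeClass {a b : V} (h : G.Adj a b) :
    Path.Homotopic.Quotient (vertexPoint G a) (vertexPoint G b) :=
  .mk (edgePath h)

theorem edgePath_symm {a b : V} (h : G.Adj a b) : edgePath h.symm = (edgePath h).symm := by
  ext t
  exact edgePoint_symm h t

/-- The classes of edge paths between vertices. -/
inductive IsEdgeClass : ∀ {x y : TriangleSquareComplex G}, Path.Homotopic.Quotient x y → Prop
  | refl (v : V) : IsEdgeClass (.refl (vertexPoint G v))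
  | edge {a b : V} (h : G.Adj a b) : IsEdgeClass (edgeClass h)
  | trans {x y z : TriangleSquareComplex G} {p : Path.Homotopic.Quotient x y}
      {q : Path.Homotopic.Quotient y z} : IsEdgeClass p → IsEdgeClass q → IsEdgeClass (p.trans q)

theorem IsEdgeClass.symm {x y : TriangleSquareComplex G} {p : Path.Homotopic.Quotient x y}
    (h : IsEdgeClass p) : IsEdgeClass p.symm := by
  induction h with
  | refl v =>
    rw [← Path.Homotopic.Quotient.mk_refl, ← Path.Homotopic.Quotient.mk_symm, Path.refl_symm]
    exact .refl v
  | edge h =>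
    rw [edgeClass, ← Path.Homotopic.Quotient.mk_symm, ← edgePath_symm]
    exact .edge h.symm
  | @trans _ _ _ p q _ _ ih ih' =>
    obtain ⟨p, rfl⟩ := Path.Homotopic.Quotient.mk_surjective p
    obtain ⟨q, rfl⟩ := Path.Homotopic.Quotient.mk_surjective q
    rw [← Path.Homotopic.Quotient.mk_trans, ← Path.Homotopic.Quotient.mk_symm, Path.trans_symm,
      Path.Homotopic.Quotient.mk_trans]
    exact .trans ih' ih

theorem isEdgeClass_refl {x : TriangleSquareComplex G} {v : V} (h : x = vertexPoint G v) :
    IsEdgeClass (.mk (Path.refl x)) := by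
  subst h
  exact .refl v

theorem isEdgeClass_edge {x y : TriangleSquareComplex G} {a b : V} (h : G.Adj a b) (γ : Path x y)
    (hγ : ∀ t, γ t = edgePoint h t) : IsEdgeClass (.mk γ) := by
  obtain rfl : vertexPoint G a = x := by rw [← γ.source, hγ, edgePoint_zero]
  obtain rfl : vertexPoint G b = y := by rw [← γ.target, hγ, edgePoint_one]
  obtain rfl : edgePath h = γ := by
    ext t
    exact (hγ t).symm
  exact .edge h

theorem IsEdgeClass.map_trans {K : Cell G} {y y' y'' : K.Model} {δ : Path y y'} {ε : Path y' y''}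
    (hδ : IsEdgeClass (.mk (δ.map (continuous_charMap K))))
    (hε : IsEdgeClass (.mk (ε.map (continuous_charMap K)))) :
    IsEdgeClass (.mk ((δ.trans ε).map (continuous_charMap K))) := by
  rw [Path.map_trans, Path.Homotopic.Quotient.mk_trans]
  exact hδ.trans hε

theorem IsEdgeClass.map_symm {K : Cell G} {y y' : K.Model} {δ : Path y y'}
    (hδ : IsEdgeClass (.mk (δ.map (continuous_charMap K)))) :
    IsEdgeClass (.mk (δ.symm.map (continuous_charMap K))) := by
  rw [← Path.map_symm, Path.Homotopic.Quotient.mk_symm]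
  exact hδ.symm

/-- The edge path in the square from `(0,0)` to `(1,0)`. -/
noncomputable def squareBottom : Path ((0, 0) : unitInterval × unitInterval) (1, 0) where
  toFun t := (t, 0)
  source' := rfl
  target' := rfl

/-- The edge path in the square from `(0,0)` to `(0,1)`. -/
noncomputable def squareLeft : Path ((0, 0) : unitInterval × unitInterval) (0, 1) where
  toFun t := (0, t)
  source' := rfl
  target' := rfl

/-- The edge path in the square from `(1,0)` to `(1,1)`. -/
noncomputable def squareRight : Path ((1, 0) : unitInterval × unitInterval) (1, 1) where
  toFun t := (1, t)
  source' := rfl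
  target' := rfl

/-- The vertices of the standard 2-simplex. -/
noncomputable def simplexVertex (i : Fin 3) : stdSimplex ℝ (Fin 3) :=
  ⟨Pi.single i 1, single_mem_stdSimplex ℝ i⟩

/-- The edge path in the standard 2-simplex between two vertices. -/
noncomputable def simplexEdge (i j : Fin 3) : Path (simplexVertex i) (simplexVertex j) where
  toFun t := ⟨(1 - (t : ℝ)) • Pi.single i 1 + (t : ℝ) • Pi.single j 1,
    convex_stdSimplex ℝ (Fin 3) (single_mem_stdSimplex ℝ i) (single_mem_stdSimplex ℝ j)
      (sub_nonneg.2 t.2.2) t.2.1 (by ring)⟩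
  continuous_toFun := by fun_prop
  source' := by simp [simplexVertex]
  target' := by simp [simplexVertex]

theorem simplexEdge_apply (i j : Fin 3) (t : unitInterval) (k : Fin 3) :
    (simplexEdge i j t).1 k =
      (1 - (t : ℝ)) * (Pi.single i 1 : Fin 3 → ℝ) k + t * (Pi.single j 1 : Fin 3 → ℝ) k := rfl

/-- Every vertex of a cell is joined in the cell to a base corner by an edge path. -/
theorem exists_corner (K : Cell G) : ∃ y₀ : K.Model, ∀ w ∈ K.verts, ∃ y : K.Model,
    K.charMap y = vertexPoint G w ∧
      ∃ δ : Path y₀ y, IsEdgeClass (.mk (δ.map (continuous_charMap K))) := by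
  cases K with
  | vertex v =>
    refine ⟨(), fun w hw => ⟨(), ?_, Path.refl _, ?_⟩⟩
    · obtain rfl : w = v := hw
      rfl
    · exact isEdgeClass_refl (v := v) rfl
  | edge a b h =>
    have h0 : (Cell.edge a b h).charMap (0 : unitInterval) = vertexPoint G a := edgePoint_zero h
    have h1 : (Cell.edge a b h).charMap (1 : unitInterval) = vertexPoint G b := edgePoint_one h
    refine ⟨(0 : unitInterval), ?_⟩
    rintro w (rfl | rfl)
    · refine ⟨_, h0, Path.refl _, ?_⟩
      exact isEdgeClass_refl h0
    · exact ⟨_, h1, (⟨⟨id, continuous_id⟩, rfl, rfl⟩ : Path (0 : unitInterval) 1),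
        isEdgeClass_edge h _ fun t => rfl⟩
  | triangle a b c h =>
    have h0 : (Cell.triangle a b c h).charMap (simplexVertex 0) = vertexPoint G a := by
      apply Subtype.ext
      simp [Cell.charMap, vertexPoint, Cell.coords, simplexVertex]
    have h1 : (Cell.triangle a b c h).charMap (simplexVertex 1) = vertexPoint G b := by
      apply Subtype.ext
      simp [Cell.charMap, vertexPoint, Cell.coords, simplexVertex]
    have h2 : (Cell.triangle a b c h).charMap (simplexVertex 2) = vertexPoint G c := by
      apply Subtype.ext
      simp [Cell.charMap, vertexPoint, Cell.coords, simplexVertex]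
    refine ⟨simplexVertex 0, ?_⟩
    rintro w (rfl | rfl | rfl)
    · refine ⟨_, h0, Path.refl _, ?_⟩
      exact isEdgeClass_refl h0
    · refine ⟨_, h1, simplexEdge 0 1, isEdgeClass_edge h.1 _ fun t => ?_⟩
      apply Subtype.ext
      change (Cell.triangle _ _ _ h).coords (simplexEdge 0 1 t) =
        (Cell.edge _ _ h.1).coords t
      rw [Cell.coords_triangle, Cell.coords_edge]
      simp [simplexEdge_apply]
    · refine ⟨_, h2, simplexEdge 0 2, isEdgeClass_edge h.2.2 _ fun t => ?_⟩
      apply Subtype.ext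
      change (Cell.triangle _ _ _ h).coords (simplexEdge 0 2 t) =
        (Cell.edge _ _ h.2.2).coords t
      rw [Cell.coords_triangle, Cell.coords_edge]
      simp [simplexEdge_apply]
  | square a b c d h =>
    have h0 : (Cell.square a b c d h).charMap ((0, 0) : unitInterval × unitInterval) =
        vertexPoint G a := by
      apply Subtype.ext
      simp [Cell.charMap, vertexPoint, Cell.coords]
    have h1 : (Cell.square a b c d h).charMap ((1, 0) : unitInterval × unitInterval) =
        vertexPoint G b := by
      apply Subtype.ext
      simp [Cell.charMap, vertexPoint, Cell.coords]
    have h2 : (Cell.square a b c d h).charMap ((1, 1) : unitInterval × unitInterval) =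
        vertexPoint G c := by
      apply Subtype.ext
      simp [Cell.charMap, vertexPoint, Cell.coords]
    have h3 : (Cell.square a b c d h).charMap ((0, 1) : unitInterval × unitInterval) =
        vertexPoint G d := by
      apply Subtype.ext
      simp [Cell.charMap, vertexPoint, Cell.coords]
    have hb : IsEdgeClass (.mk (squareBottom.map (continuous_charMap (Cell.square a b c d h)))) := by
      refine isEdgeClass_edge h.1.1 _ fun t => ?_
      apply Subtype.ext
      change (Cell.square _ _ _ _ h).coords (squareBottom t) =
        (Cell.edge _ _ h.1.1).coords t
      rw [Cell.coords_square, Cell.coords_edge]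
      simp [squareBottom]
    refine ⟨((0, 0) : unitInterval × unitInterval), ?_⟩
    rintro w (rfl | rfl | rfl | rfl)
    · refine ⟨_, h0, Path.refl _, ?_⟩
      exact isEdgeClass_refl h0
    · exact ⟨_, h1, squareBottom, hb⟩
    · refine ⟨_, h2, squareBottom.trans squareRight, ?_⟩
      have hr : IsEdgeClass (.mk (squareRight.map (continuous_charMap (Cell.square a b w d h)))) := by
        refine isEdgeClass_edge h.1.2.1 _ fun t => ?_
        apply Subtype.ext
        change (Cell.square _ _ _ _ h).coords (squareRight t) =
        (Cell.edge _ _ h.1.2.1).coords t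
        rw [Cell.coords_square, Cell.coords_edge]
        simp [squareRight]
      exact hb.map_trans hr
    · refine ⟨_, h3, squareLeft, isEdgeClass_edge h.1.2.2.2.symm _ fun t => ?_⟩
      apply Subtype.ext
      change (Cell.square _ _ _ _ h).coords (squareLeft t) =
        (Cell.edge _ _ h.1.2.2.2.symm).coords t
      rw [Cell.coords_square, Cell.coords_edge]
      simp [squareLeft]

/-- Paths in a cell between vertices are homotopic to edge paths. -/
theorem isEdgeClass_of_cell (K : Cell G) {y y' : K.Model} (δ : Path y y') {v v' : V}
    (hy : K.charMap y = vertexPoint G v) (hy' : K.charMap y' = vertexPoint G v') :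
    IsEdgeClass (.mk (δ.map (continuous_charMap K))) := by
  have hmem : ∀ {y : K.Model} {v : V}, K.charMap y = vertexPoint G v → v ∈ K.verts := by
    intro y v h
    refine K.mem_verts_of_coords_ne_zero y ?_
    have h' : K.coords y = Finsupp.single v 1 := congrArg Subtype.val h
    rw [h', Finsupp.single_eq_same]
    exact one_ne_zero
  obtain ⟨y₀, h⟩ := exists_corner K
  obtain ⟨z, hz, ε, hε⟩ := h v (hmem hy)
  obtain ⟨z', hz', ε', hε'⟩ := h v' (hmem hy')
  obtain rfl := charMap_injective K (hz.trans hy.symm)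
  obtain rfl := charMap_injective K (hz'.trans hy'.symm)
  have h1 := hε.map_symm.map_trans hε'
  -- The model of a cell is contractible, so any path in it may be replaced by one through the base
  -- corner along edges.
  have h2 : (ε.symm.trans ε').Homotopic δ := SimplyConnectedSpace.paths_homotopic _ _
  rw [Path.Homotopic.Quotient.eq.2 (h2.map ⟨_, continuous_charMap K⟩)] at h1
  exact h1

theorem isEdgeClass_of_cell_path (K : Cell G) {y y' : K.Model} (δ : Path y y')
    {x x' : TriangleSquareComplex G} (γ : Path x x') (h : ∀ t, K.charMap (δ t) = γ t) {v v' : V}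
    (hx : x = vertexPoint G v) (hx' : x' = vertexPoint G v') : IsEdgeClass (.mk γ) := by
  obtain rfl : K.charMap y = x := by rw [← δ.source, h, γ.source]
  obtain rfl : K.charMap y' = x' := by rw [← δ.target, h, γ.target]
  obtain rfl : δ.map (continuous_charMap K) = γ := Path.ext (funext h)
  exact isEdgeClass_of_cell K δ hx hx'

/-- The radial paths from a point to two vertices differ by an edge path. -/
theorem isEdgeClass_radialPath {x : TriangleSquareComplex G} {v w : V} (hv : x ∈ openStar G v)
    (hw : x ∈ openStar G w) :
    IsEdgeClass (.trans (.symm (.mk (radialPath v x hv))) (.mk (radialPath w x hw))) := by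
  obtain ⟨K, y, rfl⟩ := exists_charMap_eq x
  obtain ⟨y₁, δ₁, h₁⟩ := exists_path_radialPath v K y hv
  obtain ⟨y₂, δ₂, h₂⟩ := exists_path_radialPath w K y hw
  generalize radialPath v (K.charMap y) hv = γ₁ at *
  generalize radialPath w (K.charMap y) hw = γ₂ at *
  have e₁ : K.charMap y₁ = vertexPoint G v := by rw [← δ₁.target, h₁, γ₁.target]
  have e₂ : K.charMap y₂ = vertexPoint G w := by rw [← δ₂.target, h₂, γ₂.target]
  have key := isEdgeClass_of_cell K (δ₁.symm.trans δ₂) e₁ e₂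
  rw [Path.map_trans, ← Path.map_symm, Path.Homotopic.Quotient.mk_trans,
    Path.Homotopic.Quotient.mk_symm] at key
  clear hv hw
  revert γ₁ γ₂
  rw [← e₁, ← e₂]
  intro γ₁ h₁ γ₂ h₂
  obtain rfl : δ₁.map (continuous_charMap K) = γ₁ := Path.ext (funext h₁)
  obtain rfl : δ₂.map (continuous_charMap K) = γ₂ := Path.ext (funext h₂)
  exact key

theorem isEdgeClass_radialPath_vertex {v w : V} (hw : vertexPoint G v ∈ openStar G w) :
    IsEdgeClass (.mk (radialPath w (vertexPoint G v) hw)) := by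
  obtain ⟨y, δ, h⟩ := exists_path_radialPath w (Cell.vertex v) () hw
  exact isEdgeClass_of_cell_path (Cell.vertex v) δ (radialPath w (vertexPoint G v) hw) h rfl rfl

/-- The contraction of the star carries `γ` to a constant path, and the tracks of the ends of `γ`
are the radial paths. -/
theorem mk_eq_radialPath {v : V} {x y : TriangleSquareComplex G} (γ : Path x y)
    (hγ : ∀ t, γ t ∈ openStar G v) (hx : x ∈ openStar G v) (hy : y ∈ openStar G v) :
    Path.Homotopic.Quotient.mk γ = .trans (.mk (radialPath v x hx))
      (.symm (.mk (radialPath v y hy))) := by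
  let p : Path (⟨x, hx⟩ : openStar G v) ⟨y, hy⟩ :=
    ⟨⟨fun t => ⟨γ t, hγ t⟩, by fun_prop⟩, Subtype.ext γ.source, Subtype.ext γ.target⟩
  have h := Path.Homotopic.map_trans_evalAt (contractHomotopy v) p
  have h' : (Path.Homotopic.Quotient.mk γ).trans (.mk (radialPath v y hy)) =
      (Path.Homotopic.Quotient.mk (radialPath v x hx)).trans (.refl _) := by
    rw [← Path.Homotopic.Quotient.mk_trans, ← Path.Homotopic.Quotient.mk_refl,
      ← Path.Homotopic.Quotient.mk_trans]
    exact Path.Homotopic.Quotient.eq.2 h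
  rw [Path.Homotopic.Quotient.trans_refl] at h'
  rw [← h', Path.Homotopic.Quotient.trans_assoc, Path.Homotopic.Quotient.trans_symm,
    Path.Homotopic.Quotient.trans_refl]

/-- Every path between vertices is homotopic to an edge path. -/
theorem isEdgeClass {v w : V} (q : Path.Homotopic.Quotient (vertexPoint G v) (vertexPoint G w)) :
    IsEdgeClass q := by
  -- Each point `x` is tied to the centre `c x` of a star containing it. Conjugating by the radial
  -- paths turns arbitrary paths into paths between vertices, compatibly with concatenation.
  choose c hc using exists_mem_openStar (G := G)
  have key := path_class_induction (P := fun {x y} q => IsEdgeClass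
      ((Path.Homotopic.Quotient.symm (.mk (radialPath (c x) x (hc x)))).trans
        (q.trans (.mk (radialPath (c y) y (hc y)))))) (isOpen_openStar (G := G))
      exists_mem_openStar ?_ ?_ q
  · have h₁ := isEdgeClass_radialPath_vertex (hc (vertexPoint G v))
    have h₂ := isEdgeClass_radialPath_vertex (hc (vertexPoint G w))
    have := (h₁.trans key).trans h₂.symm
    simpa only [Path.Homotopic.Quotient.trans_assoc, trans_symm_cancel,
      Path.Homotopic.Quotient.trans_symm, Path.Homotopic.Quotient.trans_refl] using this
  · intro x y z p q hp hq
    have := hp.trans hq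
    simpa only [Path.Homotopic.Quotient.trans_assoc, trans_symm_cancel] using this
  · intro u x y γ hγ
    have hx : x ∈ openStar G u := by simpa using hγ 0
    have hy : y ∈ openStar G u := by simpa using hγ 1
    -- Through the centre `u` the path splits into two changes of centre, at `x` and at `y`, each of
    -- which takes place in one cell.
    rw [mk_eq_radialPath γ hγ hx hy]
    have := (isEdgeClass_radialPath (hc x) hx).trans (isEdgeClass_radialPath hy (hc y))
    simpa only [Path.Homotopic.Quotient.trans_assoc] using this

end EdgeClasses


/-! ### Homotopies across triangles and squares -/

section EdgeRelations

open Topology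

variable {V : Type u} {G : SimpleGraph V}

/-- The edge path in the square from `(0,1)` to `(1,1)`. -/
noncomputable def squareTop : Path ((0, 1) : unitInterval × unitInterval) (1, 1) where
  toFun t := (t, 1)
  source' := rfl
  target' := rfl

theorem mk_eq_mk_of_cell (K : Cell G) {y y' : K.Model} (δ δ' : Path y y')
    {x x' : TriangleSquareComplex G} (γ γ' : Path x x') (h : ∀ t, K.charMap (δ t) = γ t)
    (h' : ∀ t, K.charMap (δ' t) = γ' t) :
    Path.Homotopic.Quotient.mk γ = Path.Homotopic.Quotient.mk γ' := by
  obtain rfl : K.charMap y = x := by rw [← δ.source, h, γ.source]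
  obtain rfl : K.charMap y' = x' := by rw [← δ.target, h, γ.target]
  obtain rfl : δ.map (continuous_charMap K) = γ := Path.ext (funext h)
  obtain rfl : δ'.map (continuous_charMap K) = γ' := Path.ext (funext h')
  have : δ.Homotopic δ' := SimplyConnectedSpace.paths_homotopic _ _
  exact Path.Homotopic.Quotient.eq.2 (this.map ⟨_, continuous_charMap K⟩)

theorem trans_apply_congr {X Y Z : Type*} [TopologicalSpace X] [TopologicalSpace Y]
    {f : X → Z} {g : Y → Z} {x₀ x₁ x₂ : X} {y₀ y₁ y₂ : Y} {γ : Path x₀ x₁} {γ' : Path x₁ x₂}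
    {δ : Path y₀ y₁} {δ' : Path y₁ y₂} (h : ∀ t, f (γ t) = g (δ t))
    (h' : ∀ t, f (γ' t) = g (δ' t)) (t : unitInterval) :
    f (γ.trans γ' t) = g (δ.trans δ' t) := by
  rw [Path.trans_apply, Path.trans_apply]
  split_ifs
  exacts [h _, h' _]

theorem edgeClass_triangle {a b c : V} (hab : G.Adj a b) (hbc : G.Adj b c) (hac : G.Adj a c) :
    (edgeClass hab).trans (edgeClass hbc) = edgeClass hac := by
  have h : IsTriangle G a b c := ⟨hab, hbc, hac⟩
  rw [edgeClass, edgeClass, edgeClass, ← Path.Homotopic.Quotient.mk_trans]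
  refine mk_eq_mk_of_cell (Cell.triangle a b c h) ((simplexEdge 0 1).trans (simplexEdge 1 2))
    (simplexEdge 0 2) _ _ (trans_apply_congr (g := id) (fun t => ?_) fun t => ?_) fun t => ?_
  all_goals apply Subtype.ext
  · change (Cell.triangle a b c h).coords (simplexEdge 0 1 t) = (Cell.edge _ _ hab).coords t
    rw [Cell.coords_triangle, Cell.coords_edge]
    simp [simplexEdge_apply]
  · change (Cell.triangle a b c h).coords (simplexEdge 1 2 t) = (Cell.edge _ _ hbc).coords t
    rw [Cell.coords_triangle, Cell.coords_edge]
    simp [simplexEdge_apply]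
  · change (Cell.triangle a b c h).coords (simplexEdge 0 2 t) = (Cell.edge _ _ hac).coords t
    rw [Cell.coords_triangle, Cell.coords_edge]
    simp [simplexEdge_apply]

theorem edgeClass_square {a b c d : V} (hab : G.Adj a b) (hbc : G.Adj b c) (had : G.Adj a d)
    (hdc : G.Adj d c) (hac : a ≠ c) (hac' : ¬ G.Adj a c) (hbd : b ≠ d) (hbd' : ¬ G.Adj b d) :
    (edgeClass hab).trans (edgeClass hbc) = (edgeClass had).trans (edgeClass hdc) := by
  have h : IsInducedSquare G a b c d :=
    ⟨⟨hab, hbc, hdc.symm, had.symm⟩, ⟨hac, hac'⟩, ⟨hbd, hbd'⟩⟩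
  simp only [edgeClass, ← Path.Homotopic.Quotient.mk_trans]
  refine mk_eq_mk_of_cell (Cell.square a b c d h) (squareBottom.trans squareRight)
    (squareLeft.trans squareTop) _ _ (trans_apply_congr (g := id) (fun t => ?_) fun t => ?_)
    (trans_apply_congr (g := id) (fun t => ?_) fun t => ?_)
  all_goals apply Subtype.ext
  · change (Cell.square a b c d h).coords (squareBottom t) = (Cell.edge _ _ hab).coords t
    rw [Cell.coords_square, Cell.coords_edge]
    simp [squareBottom]
  · change (Cell.square a b c d h).coords (squareRight t) = (Cell.edge _ _ hbc).coords t
    rw [Cell.coords_square, Cell.coords_edge]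
    simp [squareRight]
  · change (Cell.square a b c d h).coords (squareLeft t) = (Cell.edge _ _ had).coords t
    rw [Cell.coords_square, Cell.coords_edge]
    simp [squareLeft]
  · change (Cell.square a b c d h).coords (squareTop t) = (Cell.edge _ _ hdc).coords t
    rw [Cell.coords_square, Cell.coords_edge]
    simp [squareTop, add_comm]

theorem edgeClass_symm {a b : V} (h : G.Adj a b) : edgeClass h.symm = (edgeClass h).symm := by
  rw [edgeClass, edgePath_symm]
  rfl

end EdgeRelations

/-! ### Weakly modular graphs have simply connected complexes -/

section SimplyConnected

variable {V : Type u} {G : SimpleGraph V} {v₀ : V}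

theorem IsWeaklyModular.exists_below_of_adj (h : IsWeaklyModular G) (hG : G.Connected) {a b : V}
    (hab : G.Adj a b) (hd : G.dist v₀ a = G.dist v₀ b) :
    ∃ r, G.Adj r a ∧ G.Adj r b ∧ G.dist v₀ r + 1 = G.dist v₀ a := by
  obtain h0 | h1 | h2 : G.dist v₀ a = 0 ∨ G.dist v₀ a = 1 ∨ 1 < G.dist v₀ a := by omega
  · have h0' := h0
    rw [hd] at h0'
    rw [hG.dist_eq_zero_iff] at h0 h0'
    exact (hab.ne (h0.symm.trans h0')).elim
  · have h1' := h1
    rw [hd] at h1'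
    exact ⟨v₀, SimpleGraph.dist_eq_one_iff_adj.1 h1, SimpleGraph.dist_eq_one_iff_adj.1 h1',
      by simp [h1]⟩
  · exact (h v₀).1 a b (SimpleGraph.dist_eq_one_iff_adj.2 hab) h2 hd

/-- The quadrangle condition freed of its side conditions: the triangle condition covers adjacent
`a` and `b`, and next to `v₀` the vertex `v₀` itself serves. -/
theorem IsWeaklyModular.exists_below (h : IsWeaklyModular G) (hG : G.Connected) {a b z : V}
    (haz : G.Adj a z) (hbz : G.Adj b z) (hne : a ≠ b) (hd : G.dist v₀ a = G.dist v₀ b)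
    (hz : G.dist v₀ z = G.dist v₀ a + 1) :
    ∃ r, G.Adj r a ∧ G.Adj r b ∧ G.dist v₀ r + 1 = G.dist v₀ a := by
  by_cases hab : G.Adj a b
  · exact h.exists_below_of_adj hG hab hd
  obtain h0 | h1 | h2 : G.dist v₀ a = 0 ∨ G.dist v₀ a = 1 ∨ 2 ≤ G.dist v₀ a := by omega
  · have h0' := h0
    rw [hd] at h0'
    rw [hG.dist_eq_zero_iff] at h0 h0'
    exact (hne (h0.symm.trans h0')).elim
  · have h1' := h1
    rw [hd] at h1'
    exact ⟨v₀, SimpleGraph.dist_eq_one_iff_adj.1 h1, SimpleGraph.dist_eq_one_iff_adj.1 h1',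
      by simp [h1]⟩
  · exact (h v₀).2 a b z (SimpleGraph.dist_eq_one_iff_adj.2 haz)
      (SimpleGraph.dist_eq_one_iff_adj.2 hbz) (dist_eq_two haz hbz.symm hne hab) h2 hd hz

theorem IsWeaklyModular.isLocallyWeaklyModular (h : IsWeaklyModular G) :
    IsLocallyWeaklyModular G := by
  intro u
  constructor
  · intro v w hvw huv huw
    obtain ⟨x, h₁, h₂, h₃⟩ := (h u).1 v w (SimpleGraph.dist_eq_one_iff_adj.2 hvw) (by omega)
      (by omega)
    exact ⟨x, (SimpleGraph.dist_eq_one_iff_adj.1 (by omega)).symm, h₁, h₂⟩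
  · intro v w z hzv hzw hvw huv huw huz
    obtain ⟨x, h₁, h₂, h₃⟩ := (h u).2 v w z (SimpleGraph.dist_eq_one_iff_adj.2 hzv.symm)
      (SimpleGraph.dist_eq_one_iff_adj.2 hzw.symm) hvw (by omega) (by omega) (by omega)
    exact ⟨x, (SimpleGraph.dist_eq_one_iff_adj.1 (by omega)).symm, h₁, h₂⟩

/-- The classes of geodesic edge paths from `v₀`. -/
inductive IsGeodesicClass (v₀ : V) :
    ∀ {v : V}, Path.Homotopic.Quotient (vertexPoint G v₀) (vertexPoint G v) → Prop
  | refl : IsGeodesicClass v₀ (.refl (vertexPoint G v₀))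
  | step {a b : V} {q : Path.Homotopic.Quotient (vertexPoint G v₀) (vertexPoint G a)}
      (h : G.Adj a b) (hd : G.dist v₀ b = G.dist v₀ a + 1) :
      IsGeodesicClass v₀ q → IsGeodesicClass v₀ (q.trans (edgeClass h))

theorem exists_adj_dist (hG : G.Connected) {v : V} {n : ℕ} (h : G.dist v₀ v = n + 1) :
    ∃ a, G.Adj a v ∧ G.dist v₀ a = n := by
  obtain ⟨p, hp⟩ := hG.exists_walk_length_eq_dist v v₀
  rw [SimpleGraph.dist_comm, h] at hp
  cases p with
  | nil => simp at hp
  | @cons _ a _ hadj p =>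
    refine ⟨a, hadj.symm, ?_⟩
    have h₁ := SimpleGraph.dist_le p
    have h₂ := hG.dist_triangle (u := v₀) (v := a) (w := v)
    rw [SimpleGraph.dist_eq_one_iff_adj.2 hadj.symm] at h₂
    rw [SimpleGraph.dist_comm] at h₁
    simp at hp
    omega

theorem exists_isGeodesicClass (hG : G.Connected) (v₀ v : V) :
    ∃ q : Path.Homotopic.Quotient (vertexPoint G v₀) (vertexPoint G v), IsGeodesicClass v₀ q := by
  induction hn : G.dist v₀ v generalizing v with
  | zero =>
    obtain rfl := hG.dist_eq_zero_iff.1 hn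
    exact ⟨_, .refl⟩
  | succ n ih =>
    obtain ⟨a, ha, had⟩ := exists_adj_dist hG hn
    obtain ⟨q, hq⟩ := ih a had
    exact ⟨_, .step ha (by omega) hq⟩

/-- Induction on the distance of the end `v`. If the last edges start at different vertices `a` and
`b`, both geodesics may be rerouted through a common neighbour `r` closer to `v₀`. What remains is
bounded by two triangles if `a` and `b` are adjacent, and otherwise by a square, induced because `r`
and `v` are two levels apart. -/
theorem IsGeodesicClass.eq (h : IsWeaklyModular G) (hG : G.Connected) {v : V}
    {q q' : Path.Homotopic.Quotient (vertexPoint G v₀) (vertexPoint G v)}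
    (hq : IsGeodesicClass v₀ q) (hq' : IsGeodesicClass v₀ q') : q = q' := by
  induction hn : G.dist v₀ v using Nat.strong_induction_on generalizing v with
  | _ n ih =>
  subst hn
  cases hq with
  | refl =>
    cases hq' with
    | refl => rfl
    | step _ hd _ => simp at hd
  | @step a _ q hav hd hq =>
    cases hq' with
    | refl => simp at hd
    | @step b _ q' hbv hd' hq' =>
      by_cases hab : a = b
      · subst hab
        rw [ih _ (by omega) hq hq' rfl]
      obtain ⟨r, hra, hrb, hr⟩ := h.exists_below hG hav hbv hab (by omega) hd
      obtain ⟨q₀, hq₀⟩ := exists_isGeodesicClass hG v₀ r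
      rw [ih _ (by omega) hq (.step hra hr.symm hq₀) rfl,
        ih _ (by omega) hq' (.step hrb (by omega) hq₀) rfl,
        Path.Homotopic.Quotient.trans_assoc, Path.Homotopic.Quotient.trans_assoc]
      congr 1
      by_cases hab' : G.Adj a b
      · rw [← edgeClass_triangle hab' hbv hav, ← edgeClass_triangle hra hab' hrb,
          Path.Homotopic.Quotient.trans_assoc]
      · refine edgeClass_square _ _ _ _ ?_ ?_ hab hab'
        · rintro rfl
          omega
        · intro hrv
          have := hG.dist_triangle (u := v₀) (v := r) (w := v)
          rw [SimpleGraph.dist_eq_one_iff_adj.2 hrv] at this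
          omega

/-- An edge that changes the distance from `v₀` extends a geodesic in one of its directions; an edge
that keeps it bounds a triangle with a lower vertex. -/
theorem IsGeodesicClass.trans_edgeClass (h : IsWeaklyModular G) (hG : G.Connected) {a b : V}
    {q : Path.Homotopic.Quotient (vertexPoint G v₀) (vertexPoint G a)}
    {q' : Path.Homotopic.Quotient (vertexPoint G v₀) (vertexPoint G b)}
    (hq : IsGeodesicClass v₀ q) (hq' : IsGeodesicClass v₀ q') (hab : G.Adj a b) :
    q.trans (edgeClass hab) = q' := by
  have h₁ := hG.dist_triangle (u := v₀) (v := a) (w := b)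
  have h₂ := hG.dist_triangle (u := v₀) (v := b) (w := a)
  rw [SimpleGraph.dist_eq_one_iff_adj.2 hab] at h₁
  rw [SimpleGraph.dist_eq_one_iff_adj.2 hab.symm] at h₂
  obtain hd | hd | hd : G.dist v₀ b = G.dist v₀ a + 1 ∨ G.dist v₀ a = G.dist v₀ b + 1 ∨
      G.dist v₀ a = G.dist v₀ b := by omega
  · exact (IsGeodesicClass.step hab hd hq).eq h hG hq'
  · rw [← (IsGeodesicClass.step hab.symm hd hq').eq h hG hq, edgeClass_symm hab,
      Path.Homotopic.Quotient.trans_assoc, Path.Homotopic.Quotient.symm_trans,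
      Path.Homotopic.Quotient.trans_refl]
  · obtain ⟨r, hra, hrb, hr⟩ := h.exists_below_of_adj hG hab hd
    obtain ⟨q₀, hq₀⟩ := exists_isGeodesicClass hG v₀ r
    rw [← (IsGeodesicClass.step hra hr.symm hq₀).eq h hG hq,
      ← (IsGeodesicClass.step hrb (by omega) hq₀).eq h hG hq',
      Path.Homotopic.Quotient.trans_assoc, edgeClass_triangle]

theorem IsEdgeClass.exists_vertex {x y : TriangleSquareComplex G}
    {q : Path.Homotopic.Quotient x y} (hq : IsEdgeClass q) :
    (∃ v, vertexPoint G v = x) ∧ ∃ w, vertexPoint G w = y := by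
  induction hq with
  | refl v => exact ⟨⟨v, rfl⟩, ⟨v, rfl⟩⟩
  | edge h => exact ⟨⟨_, rfl⟩, ⟨_, rfl⟩⟩
  | trans _ _ ih ih' => exact ⟨ih.1, ih'.2⟩

/-- The family `c` acts as a potential: compatible with edges, it determines the class of every edge
path by its ends. The casts are there because the induction runs over arbitrary points as ends. -/
theorem IsEdgeClass.trans_eq
    {c : ∀ v : V, Path.Homotopic.Quotient (vertexPoint G v₀) (vertexPoint G v)}
    (hc : ∀ {a b : V} (h : G.Adj a b), (c a).trans (edgeClass h) = c b)
    {x y : TriangleSquareComplex G} {q : Path.Homotopic.Quotient x y} (hq : IsEdgeClass q)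
    {v w : V} (hx : vertexPoint G v = x) (hy : vertexPoint G w = y) :
    (c v).trans (q.cast hx hy) = c w := by
  induction hq generalizing v w with
  | refl u =>
    obtain rfl := vertexPoint_injective hx
    obtain rfl := vertexPoint_injective hy
    simp
  | edge h =>
    obtain rfl := vertexPoint_injective hx
    obtain rfl := vertexPoint_injective hy
    simpa using hc h
  | @trans _ _ _ p q hp hq ih ih' =>
    obtain ⟨u, rfl⟩ := hp.exists_vertex.2
    subst hx hy
    have h₁ := ih rfl rfl
    have h₂ := ih' rfl rfl
    simp only [Path.Homotopic.Quotient.cast_rfl_rfl] at h₁ h₂ ⊢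
    rw [← Path.Homotopic.Quotient.trans_assoc, h₁, h₂]

theorem joined_vertexPoint (hG : G.Connected) (x : TriangleSquareComplex G) :
    Joined x (vertexPoint G v₀) := by
  obtain ⟨v, hv⟩ := exists_mem_openStar x
  obtain ⟨q, -⟩ := exists_isGeodesicClass hG v₀ v
  obtain ⟨γ, -⟩ := Path.Homotopic.Quotient.mk_surjective q
  exact ⟨(radialPath v x hv).trans γ.symm⟩

theorem IsWeaklyModular.simplyConnectedSpace (h : IsWeaklyModular G) (hG : G.Connected) :
    SimplyConnectedSpace (TriangleSquareComplex G) := by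
  obtain ⟨v₀⟩ := hG.nonempty
  rw [simply_connected_iff_paths_homotopic]
  refine ⟨⟨⟨vertexPoint G v₀⟩, fun x y =>
    (joined_vertexPoint (v₀ := v₀) hG x).trans (joined_vertexPoint hG y).symm⟩, fun x y => ⟨?_⟩⟩
  choose c hc using fun v => exists_isGeodesicClass hG v₀ v
  have hc' : ∀ {a b : V} (h : G.Adj a b), (c a).trans (edgeClass h) = c b := fun hab =>
    (hc _).trans_edgeClass h hG (hc _) hab
  have key : ∀ {v w : V} (q : Path.Homotopic.Quotient (vertexPoint G v) (vertexPoint G w)),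
      q = (c v).symm.trans (c w) := by
    intro v w q
    have := (isEdgeClass q).trans_eq hc' rfl rfl
    rw [Path.Homotopic.Quotient.cast_rfl_rfl] at this
    rw [← this, symm_trans_cancel]
  intro q q'
  obtain ⟨v, hv⟩ := exists_mem_openStar x
  obtain ⟨w, hw⟩ := exists_mem_openStar y
  set a := Path.Homotopic.Quotient.mk (radialPath v x hv)
  set b := Path.Homotopic.Quotient.mk (radialPath w y hw)
  -- Radial paths move the ends to vertices, where the class is determined by the potential `c`.
  have hq : a.symm.trans (q.trans b) = a.symm.trans (q'.trans b) := by
    rw [key (a.symm.trans (q.trans b)), key (a.symm.trans (q'.trans b))]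
  have h₁ := congrArg (fun r => (a.trans r).trans b.symm) hq
  simpa only [trans_symm_cancel, Path.Homotopic.Quotient.trans_assoc,
    Path.Homotopic.Quotient.trans_symm, Path.Homotopic.Quotient.trans_refl] using h₁

end SimplyConnected


/-! ### Cell coverings induce covering maps of complexes -/

section Functoriality

open Topology

variable {V : Type u} {W : Type w} {H : SimpleGraph W} {G : SimpleGraph V} {f : W → V}

theorem Cell.adj_or_exists_adj (K : Cell G) {a b : V} (ha : a ∈ K.verts) (hb : b ∈ K.verts) :
    a = b ∨ G.Adj a b ∨ (a ≠ b ∧ ¬ G.Adj a b ∧ ∃ c, G.Adj a c ∧ G.Adj c b) := by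
  cases K with
  | vertex v => exact Or.inl (Eq.trans ha (Eq.symm hb))
  | edge c d h =>
    rcases ha with rfl | rfl <;> rcases hb with rfl | rfl <;> simp [h, h.symm]
  | triangle c d e h =>
    obtain ⟨h₁, h₂, h₃⟩ := h
    rcases ha with rfl | rfl | rfl <;> rcases hb with rfl | rfl | rfl <;>
      simp [h₁, h₂, h₃, h₁.symm, h₂.symm, h₃.symm]
  | square c d e f h =>
    obtain ⟨⟨h₁, h₂, h₃, h₄⟩, ⟨h₅, h₆⟩, ⟨h₇, h₈⟩⟩ := h
    rcases ha with rfl | rfl | rfl | rfl <;> rcases hb with rfl | rfl | rfl | rfl <;>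
      first
      | exact Or.inl rfl
      | exact Or.inr (Or.inl (by first | assumption | (apply SimpleGraph.Adj.symm; assumption)))
      | exact Or.inr (Or.inr ⟨h₅, h₆, _, h₁, h₂⟩)
      | exact Or.inr (Or.inr ⟨h₅.symm, fun h => h₆ h.symm, _, h₃, h₄⟩)
      | exact Or.inr (Or.inr ⟨h₇, h₈, _, h₂, h₃⟩)
      | exact Or.inr (Or.inr ⟨h₇.symm, fun h => h₈ h.symm, _, h₄, h₁⟩)

/-- Non-adjacent vertices of a cell are opposite corners of a square. Bilinear coordinates are
products, so if both corners have nonzero coordinates, so has a corner between them. -/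
theorem Cell.exists_between_of_not_adj (K : Cell G) (y : K.Model) {a b : V}
    (ha : K.coords y a ≠ 0) (hb : K.coords y b ≠ 0) (hne : a ≠ b) (hab : ¬ G.Adj a b) :
    ∃ c, K.coords y c ≠ 0 ∧ G.Adj a c ∧ G.Adj c b := by
  have ha' := K.mem_verts_of_coords_ne_zero y ha
  have hb' := K.mem_verts_of_coords_ne_zero y hb
  cases K with
  | vertex v => exact (hne (Eq.trans ha' (Eq.symm hb'))).elim
  | edge c d h =>
    rcases ha' with rfl | rfl <;> rcases hb' with rfl | rfl <;> simp [h, h.symm] at hne hab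
  | triangle c d e h =>
    obtain ⟨h₁, h₂, h₃⟩ := id h
    rcases ha' with rfl | rfl | rfl <;> rcases hb' with rfl | rfl | rfl <;>
      simp [h₁, h₂, h₃, h₁.symm, h₂.symm, h₃.symm] at hne hab
  | square p q r s h =>
    obtain ⟨⟨h₁, h₂, h₃, h₄⟩, ⟨h₅, h₆⟩, ⟨h₇, h₈⟩⟩ := id h
    change unitInterval × unitInterval at y
    have hp : (Cell.square p q r s h).coords y p = (1 - (y.1 : ℝ)) * (1 - (y.2 : ℝ)) := by
      rw [coords_square]
      simp [h₁.ne', h₄.ne, h₅.symm]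
    have hq : (Cell.square p q r s h).coords y q = (y.1 : ℝ) * (1 - (y.2 : ℝ)) := by
      rw [coords_square]
      simp [h₁.ne, h₂.ne', h₇.symm]
    have hr : (Cell.square p q r s h).coords y r = (y.1 : ℝ) * (y.2 : ℝ) := by
      rw [coords_square]
      simp [h₂.ne, h₃.ne', h₅]
    have hs : (Cell.square p q r s h).coords y s = (1 - (y.1 : ℝ)) * (y.2 : ℝ) := by
      rw [coords_square]
      simp [h₃.ne, h₄.ne', h₇]
    have hpr : (Cell.square p q r s h).coords y p ≠ 0 → (Cell.square p q r s h).coords y r ≠ 0 →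
        (Cell.square p q r s h).coords y q ≠ 0 := by
      rw [hp, hq, hr]
      intro h h'
      exact mul_ne_zero (left_ne_zero_of_mul h') (right_ne_zero_of_mul h)
    have hqs : (Cell.square p q r s h).coords y q ≠ 0 → (Cell.square p q r s h).coords y s ≠ 0 →
        (Cell.square p q r s h).coords y r ≠ 0 := by
      rw [hq, hr, hs]
      intro h h'
      exact mul_ne_zero (left_ne_zero_of_mul h) (right_ne_zero_of_mul h')
    rcases ha' with rfl | rfl | rfl | rfl <;> rcases hb' with rfl | rfl | rfl | rfl <;>
      first
      | exact (hne rfl).elim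
      | exact (hab (by assumption)).elim
      | exact (hab (by apply SimpleGraph.Adj.symm; assumption)).elim
      | exact ⟨_, hpr ha hb, h₁, h₂⟩
      | exact ⟨_, hpr hb ha, h₂.symm, h₁.symm⟩
      | exact ⟨_, hqs ha hb, h₂, h₃⟩
      | exact ⟨_, hqs hb ha, h₃.symm, h₂.symm⟩

theorem IsCellCovering.adj_of_mem_verts (hf : IsCellCovering H G f) {K : Cell H} {a b : W}
    (ha : a ∈ K.verts) (hb : b ∈ K.verts) (h : G.Adj (f a) (f b)) : H.Adj a b := by
  rcases K.adj_or_exists_adj ha hb with rfl | h' | ⟨hne, hna, c, hac, hcb⟩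
  · exact (G.loopless.irrefl _ h).elim
  · exact h'
  · exact (hf.not_adj hac hcb hna h).elim

theorem IsCellCovering.eq_of_mem_verts (hf : IsCellCovering H G f) {K : Cell H} {a b : W}
    (ha : a ∈ K.verts) (hb : b ∈ K.verts) (h : f a = f b) : a = b := by
  rcases K.adj_or_exists_adj ha hb with h' | h' | ⟨hne, hna, c, hac, hcb⟩
  · exact h'
  · exact ((hf.map_adj h').ne h).elim
  · exact (hf.ne_of_adj hac hcb hne h).elim

/-- The image of a cell under a covering. -/
theorem IsCellCovering.exists_image (hf : IsCellCovering H G f) (K : Cell H) :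
    ∃ (L : Cell G) (φ : K.Model → L.Model), ∀ y,
      L.coords (φ y) = Finsupp.mapDomain f (K.coords y) := by
  cases K with
  | vertex v =>
    refine ⟨.vertex (f v), id, fun y => ?_⟩
    exact Finsupp.mapDomain_single.symm
  | edge a b h =>
    refine ⟨.edge (f a) (f b) (hf.map_adj h), id, fun y => ?_⟩
    rw [Cell.coords_edge h y, Finsupp.mapDomain_add, Finsupp.mapDomain_single,
      Finsupp.mapDomain_single]
    rfl
  | triangle a b c h =>
    refine ⟨.triangle (f a) (f b) (f c) ⟨hf.map_adj h.1, hf.map_adj h.2.1, hf.map_adj h.2.2⟩, id,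
      fun y => ?_⟩
    rw [Cell.coords_triangle h y]
    simp only [Finsupp.mapDomain_add, Finsupp.mapDomain_single]
    rfl
  | square a b c d h =>
    refine ⟨.square (f a) (f b) (f c) (f d) ⟨⟨hf.map_adj h.1.1, hf.map_adj h.1.2.1,
      hf.map_adj h.1.2.2.1, hf.map_adj h.1.2.2.2⟩,
      ⟨hf.ne_of_adj h.1.1 h.1.2.1 h.2.1.1, hf.not_adj h.1.1 h.1.2.1 h.2.1.2⟩,
      ⟨hf.ne_of_adj h.1.2.1 h.1.2.2.1 h.2.2.1, hf.not_adj h.1.2.1 h.1.2.2.1 h.2.2.2⟩⟩, id,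
      fun y => ?_⟩
    rw [Cell.coords_square h y]
    simp only [Finsupp.mapDomain_add, Finsupp.mapDomain_single]
    rfl

theorem IsCellCovering.exists_triangle_lift (hf : IsCellCovering H G f) {a : W} {b c : V}
    (h : IsTriangle G (f a) b c) : ∃ b' c', IsTriangle H a b' c' ∧ f b' = b ∧ f c' = c := by
  obtain ⟨h₁, h₂, h₃⟩ := h
  obtain ⟨b', hb', rfl⟩ := hf.exists_lift h₁
  obtain ⟨c', hc', rfl⟩ := hf.exists_lift h₃
  exact ⟨b', c', ⟨hb', hf.triangle hb' hc' h₂, hc'⟩, rfl, rfl⟩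

theorem IsCellCovering.exists_square_lift (hf : IsCellCovering H G f) {a : W} {b c d : V}
    (h : IsInducedSquare G (f a) b c d) :
    ∃ b' c' d', IsInducedSquare H a b' c' d' ∧ f b' = b ∧ f c' = c ∧ f d' = d := by
  obtain ⟨⟨h₁, h₂, h₃, h₄⟩, ⟨h₅, h₆⟩, ⟨h₇, h₈⟩⟩ := h
  obtain ⟨b', hb', rfl⟩ := hf.exists_lift h₁
  obtain ⟨d', hd', rfl⟩ := hf.exists_lift h₄.symm
  obtain ⟨c', hc', hc'', rfl⟩ := hf.square hb' hd' h₂ h₃.symm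
  refine ⟨b', c', d', ⟨⟨hb', hc', hc''.symm, hd'.symm⟩, ⟨?_, ?_⟩, ⟨?_, ?_⟩⟩, rfl, rfl, rfl⟩
  · rintro rfl; exact h₅ rfl
  · exact fun h => h₆ (hf.map_adj h)
  · rintro rfl; exact h₇ rfl
  · exact fun h => h₈ (hf.map_adj h)

theorem IsInducedSquare.rotate {a b c d : V} (h : IsInducedSquare G a b c d) :
    IsInducedSquare G b c d a :=
  ⟨⟨h.1.2.1, h.1.2.2.1, h.1.2.2.2, h.1.1⟩, h.2.2, ⟨h.2.1.1.symm, fun h' => h.2.1.2 h'.symm⟩⟩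

theorem IsTriangle.rotate {a b c : V} (h : IsTriangle G a b c) : IsTriangle G b c a :=
  ⟨h.2.1, h.2.2.symm, h.1.symm⟩

/-- The lift of a cell at a vertex. -/
theorem IsCellCovering.exists_cell_lift (hf : IsCellCovering H G f) (L : Cell G) {a : W}
    (ha : f a ∈ L.verts) : ∃ K : Cell H, a ∈ K.verts ∧ ∃ φ : L.Model → K.Model, Continuous φ ∧
      ∀ y, Finsupp.mapDomain f (K.coords (φ y)) = L.coords y := by
  cases L with
  | vertex v =>
    obtain rfl : f a = v := ha
    refine ⟨.vertex a, rfl, id, continuous_id, fun y => ?_⟩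
    exact Finsupp.mapDomain_single
  | edge b c h =>
    obtain ⟨b', c', h', hmem, rfl, rfl⟩ : ∃ b' c', ∃ _ : H.Adj b' c',
        a ∈ ({b', c'} : Set W) ∧ f b' = b ∧ f c' = c := by
      rcases ha with rfl | rfl
      · obtain ⟨c', hc', rfl⟩ := hf.exists_lift h
        exact ⟨a, c', hc', by simp, rfl, rfl⟩
      · obtain ⟨c', hc', rfl⟩ := hf.exists_lift h.symm
        exact ⟨c', a, hc'.symm, by simp, rfl, rfl⟩
    refine ⟨.edge b' c' h', hmem, id, continuous_id, fun y => ?_⟩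
    rw [Cell.coords_edge h y]
    change Finsupp.mapDomain f ((Cell.edge b' c' h').coords y) = _
    rw [Cell.coords_edge h' y]
    simp only [Finsupp.mapDomain_add, Finsupp.mapDomain_single]
  | triangle b c d h =>
    obtain ⟨b', c', d', h', hmem, rfl, rfl, rfl⟩ : ∃ b' c' d', ∃ _ : IsTriangle H b' c' d',
        a ∈ ({b', c', d'} : Set W) ∧ f b' = b ∧ f c' = c ∧ f d' = d := by
      rcases ha with rfl | rfl | rfl
      · obtain ⟨b', c', h', rfl, rfl⟩ := hf.exists_triangle_lift h
        exact ⟨a, b', c', h', by simp, rfl, rfl, rfl⟩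
      · obtain ⟨b', c', h', rfl, rfl⟩ := hf.exists_triangle_lift h.rotate
        exact ⟨c', a, b', h'.rotate.rotate, by simp, rfl, rfl, rfl⟩
      · obtain ⟨b', c', h', rfl, rfl⟩ := hf.exists_triangle_lift h.rotate.rotate
        exact ⟨b', c', a, h'.rotate, by simp, rfl, rfl, rfl⟩
    refine ⟨.triangle b' c' d' h', hmem, id, continuous_id, fun y => ?_⟩
    rw [Cell.coords_triangle h y]
    change Finsupp.mapDomain f ((Cell.triangle b' c' d' h').coords y) = _
    rw [Cell.coords_triangle h' y]
    simp only [Finsupp.mapDomain_add, Finsupp.mapDomain_single]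
  | square b c d e h =>
    obtain ⟨b', c', d', e', h', hmem, rfl, rfl, rfl, rfl⟩ : ∃ b' c' d' e',
        ∃ _ : IsInducedSquare H b' c' d' e',
        a ∈ ({b', c', d', e'} : Set W) ∧ f b' = b ∧ f c' = c ∧ f d' = d ∧ f e' = e := by
      rcases ha with rfl | rfl | rfl | rfl
      · obtain ⟨b', c', d', h', rfl, rfl, rfl⟩ := hf.exists_square_lift h
        exact ⟨a, b', c', d', h', by simp, rfl, rfl, rfl, rfl⟩
      · obtain ⟨b', c', d', h', rfl, rfl, rfl⟩ := hf.exists_square_lift h.rotate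
        exact ⟨d', a, b', c', h'.rotate.rotate.rotate, by simp, rfl, rfl, rfl, rfl⟩
      · obtain ⟨b', c', d', h', rfl, rfl, rfl⟩ := hf.exists_square_lift h.rotate.rotate
        exact ⟨c', d', a, b', h'.rotate.rotate, by simp, rfl, rfl, rfl, rfl⟩
      · obtain ⟨b', c', d', h', rfl, rfl, rfl⟩ := hf.exists_square_lift h.rotate.rotate.rotate
        exact ⟨b', c', d', a, h'.rotate, by simp, rfl, rfl, rfl, rfl⟩
    refine ⟨.square b' c' d' e' h', hmem, id, continuous_id, fun y => ?_⟩
    rw [Cell.coords_square h y]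
    change Finsupp.mapDomain f ((Cell.square b' c' d' e' h').coords y) = _
    rw [Cell.coords_square h' y]
    simp only [Finsupp.mapDomain_add, Finsupp.mapDomain_single]

/-- The map of triangle-square complexes induced by a covering. -/
noncomputable def IsCellCovering.map (hf : IsCellCovering H G f) (x : TriangleSquareComplex H) :
    TriangleSquareComplex G :=
  ⟨Finsupp.mapDomain f x.1, by
    obtain ⟨x, K, y, rfl⟩ := x
    obtain ⟨L, φ, h⟩ := hf.exists_image K
    exact ⟨L, φ y, h y⟩⟩

theorem IsCellCovering.map_vertexPoint (hf : IsCellCovering H G f) (a : W) :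
    hf.map (vertexPoint H a) = vertexPoint G (f a) :=
  Subtype.ext Finsupp.mapDomain_single

theorem IsCellCovering.map_edgePoint (hf : IsCellCovering H G f) {a b : W} (h : H.Adj a b)
    (t : unitInterval) : hf.map (edgePoint h t) = edgePoint (hf.map_adj h) t := by
  apply Subtype.ext
  change Finsupp.mapDomain f ((Cell.edge a b h).coords t) =
    (Cell.edge _ _ (hf.map_adj h)).coords t
  rw [Cell.coords_edge, Cell.coords_edge]
  simp only [Finsupp.mapDomain_add, Finsupp.mapDomain_single]

theorem IsCellCovering.mapDomain_apply (hf : IsCellCovering H G f) (K : Cell H) (y : K.Model)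
    {a : W} (ha : a ∈ K.verts) : Finsupp.mapDomain f (K.coords y) (f a) = K.coords y a := by
  classical
  rw [Finsupp.mapDomain, Finsupp.sum_apply, Finsupp.sum, Finset.sum_eq_single a]
  · simp
  · intro b hb hba
    rw [Finsupp.mem_support_iff] at hb
    refine Finsupp.single_eq_of_ne fun h => hba ?_
    exact (hf.eq_of_mem_verts ha (K.mem_verts_of_coords_ne_zero y hb) h).symm
  · intro h
    rw [Finsupp.notMem_support_iff.1 h]
    simp

theorem exists_of_mapDomain_ne_zero {x : W →₀ ℝ} {v : V} (h : Finsupp.mapDomain f x v ≠ 0) :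
    ∃ a, x a ≠ 0 ∧ f a = v := by
  classical
  have := Finsupp.mapDomain_support (Finsupp.mem_support_iff.2 h)
  obtain ⟨a, ha, rfl⟩ := Finset.mem_image.1 this
  exact ⟨a, Finsupp.mem_support_iff.1 ha, rfl⟩

/-- Points with equal images have supports over the same vertices of `G`. Starting from the shared
vertex `a`, uniqueness of lifts of neighbours identifies the supports, passing through an
intermediate vertex when `b` is opposite to `a`. -/
theorem IsCellCovering.coords_ne_zero_of_map_eq (hf : IsCellCovering H G f) {a : W} {K K' : Cell H}
    {y : K.Model} {y' : K'.Model} (ha : K.coords y a ≠ 0) (ha' : K'.coords y' a ≠ 0)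
    (h : Finsupp.mapDomain f (K.coords y) = Finsupp.mapDomain f (K'.coords y')) {b : W}
    (hb : K.coords y b ≠ 0) : K'.coords y' b ≠ 0 := by
  have haK := K.mem_verts_of_coords_ne_zero y ha
  have haK' := K'.mem_verts_of_coords_ne_zero y' ha'
  have hex : ∀ b, K.coords y b ≠ 0 → ∃ b', K'.coords y' b' ≠ 0 ∧ f b' = f b := by
    intro b hb
    refine exists_of_mapDomain_ne_zero (f := f) ?_
    rwa [← h, hf.mapDomain_apply K y (K.mem_verts_of_coords_ne_zero y hb)]
  have hadj : ∀ b, H.Adj a b → K.coords y b ≠ 0 → K'.coords y' b ≠ 0 := by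
    intro b hab hb
    obtain ⟨b', hb', hbb⟩ := hex b hb
    have := hf.adj_of_mem_verts haK' (K'.mem_verts_of_coords_ne_zero y' hb')
      (hbb ▸ hf.map_adj hab)
    rwa [hf.unique hab this hbb.symm]
  by_cases hne : a = b
  · rwa [← hne]
  by_cases hab : H.Adj a b
  · exact hadj b hab hb
  obtain ⟨c, hc, hac, hcb⟩ := K.exists_between_of_not_adj y ha hb hne hab
  obtain ⟨b', hb', hbb⟩ := hex b hb
  have hcK' := K'.mem_verts_of_coords_ne_zero y' (hadj c hac hc)
  have := hf.adj_of_mem_verts hcK' (K'.mem_verts_of_coords_ne_zero y' hb')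
    (hbb ▸ hf.map_adj hcb)
  rwa [hf.unique hcb this hbb.symm]

theorem IsCellCovering.injOn_openStar (hf : IsCellCovering H G f) (a : W) :
    (openStar H a).InjOn hf.map := by
  intro x hx x' hx' h
  obtain ⟨K, y, rfl⟩ := exists_charMap_eq x
  obtain ⟨K', y', rfl⟩ := exists_charMap_eq x'
  replace h : Finsupp.mapDomain f (K.coords y) = Finsupp.mapDomain f (K'.coords y') :=
    congrArg Subtype.val h
  apply Subtype.ext
  ext b
  change K.coords y b = K'.coords y' b
  by_cases hb : K.coords y b = 0
  · by_cases hb' : K'.coords y' b = 0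
    · rw [hb, hb']
    · exact (hf.coords_ne_zero_of_map_eq hx' hx h.symm hb' hb).elim
  · have hb' := hf.coords_ne_zero_of_map_eq hx hx' h hb
    rw [← hf.mapDomain_apply K y (K.mem_verts_of_coords_ne_zero y hb), h,
      hf.mapDomain_apply K' y' (K'.mem_verts_of_coords_ne_zero y' hb')]

theorem IsCellCovering.continuous_map (hf : IsCellCovering H G f) : Continuous hf.map := by
  refine continuous_iSup_dom.2 fun K => continuous_coinduced_dom.2 ?_
  obtain ⟨L, φ, h⟩ := hf.exists_image K
  have hφ : Continuous φ := by
    refine L.isInducing_coords.continuous_iff.2 (continuous_pi fun v => ?_)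
    change Continuous fun y => L.coords (φ y) v
    simp only [h]
    exact K.continuous_map_coords ((Finsupp.lapply v).comp (Finsupp.lmapDomain ℝ ℝ f))
  have : hf.map ∘ K.charMap = L.charMap ∘ φ := funext fun y => Subtype.ext (h y).symm
  rw [this]
  exact (continuous_charMap L).comp hφ

/-- In the weak topology only the cells of `G` at `f a` matter, since the others miss the open star;
these lift to cells of `H` at `a`. -/
theorem IsCellCovering.isOpen_iff (hf : IsCellCovering H G f) (a : W)
    {s : Set (TriangleSquareComplex G)} (hs : s ⊆ openStar G (f a)) :
    IsOpen s ↔ IsOpen (hf.map ⁻¹' s ∩ openStar H a) := by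
  refine ⟨fun h => (h.preimage hf.continuous_map).inter (isOpen_openStar a), fun h => ?_⟩
  rw [isOpen_complex_iff] at h ⊢
  intro L
  by_cases ha : f a ∈ L.verts
  · obtain ⟨K, haK, φ, hφ, hφ'⟩ := hf.exists_cell_lift L ha
    convert! (h K).preimage hφ using 1
    ext y
    have e : hf.map (K.charMap (φ y)) = L.charMap y := Subtype.ext (hφ' y)
    simp only [Set.mem_preimage, Set.mem_inter_iff, e]
    refine ⟨fun hy => ⟨hy, ?_⟩, fun hy => hy.1⟩
    have h1 := hs hy
    change K.coords (φ y) a ≠ 0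
    rw [← hf.mapDomain_apply K _ haK, hφ']
    exact h1
  · convert! isOpen_empty
    ext y
    simp only [Set.mem_preimage, Set.mem_empty_iff_false, iff_false]
    exact fun hy => ha (L.mem_verts_of_coords_ne_zero y (hs hy))

/-- The open star of `v` is evenly covered by the open stars of the vertices over `v`. They are
disjoint because distinct vertices of one cell have distinct images. -/
theorem IsCellCovering.isCoveringMap (hf : IsCellCovering H G f) (hsurj : Function.Surjective f) :
    IsCoveringMap hf.map := by
  intro x
  obtain ⟨v, hv⟩ := exists_mem_openStar x
  obtain ⟨a₀, ha₀⟩ := hsurj v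
  let _ : TopologicalSpace {a : W // f a = v} := ⊥
  have : DiscreteTopology {a : W // f a = v} := ⟨rfl⟩
  have : Nonempty {a : W // f a = v} := ⟨⟨a₀, ha₀⟩⟩
  have : Nonempty (TriangleSquareComplex G → TriangleSquareComplex H) :=
    ⟨fun _ => vertexPoint H a₀⟩
  let t : Bundle.Trivialization {a : W // f a = v} hf.map :=
    IsOpen.trivializationDiscrete (fun a : {a : W // f a = v} => openStar H a.1) (openStar G v)
      (isOpen_openStar v) ?_ ?_ ?_ ?_ ?_
  · exact (IsEvenlyCovered.of_trivialization (t := t) hv).to_isEvenlyCovered_preimage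
  · rintro ⟨a, rfl⟩ s hs
    exact hf.isOpen_iff a hs
  · exact fun a => hf.injOn_openStar a.1
  · rintro ⟨a, rfl⟩ x hx
    obtain ⟨L, y, rfl⟩ := exists_charMap_eq x
    obtain ⟨K, haK, φ, -, hφ⟩ := hf.exists_cell_lift L (L.mem_verts_of_coords_ne_zero y hx)
    refine ⟨K.charMap (φ y), ?_, Subtype.ext (hφ y)⟩
    change K.coords (φ y) a ≠ 0
    rw [← hf.mapDomain_apply K _ haK, hφ]
    exact hx
  · rintro ⟨a, rfl⟩ ⟨b, hb⟩ hne
    refine Set.disjoint_left.2 fun x hx hx' => hne ?_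
    obtain ⟨K, y, rfl⟩ := exists_charMap_eq x
    exact Subtype.ext (hf.eq_of_mem_verts (K.mem_verts_of_coords_ne_zero y hx)
      (K.mem_verts_of_coords_ne_zero y hx') hb.symm)
  · intro x hx
    obtain ⟨a, ha, ha'⟩ := exists_of_mapDomain_ne_zero hx
    exact Set.mem_iUnion.2 ⟨⟨a, ha'⟩, ha⟩

end Functoriality


/-! ### The 1-skeleton of a covering space -/

section OneSkeleton

open Topology

variable {V : Type u} {G : SimpleGraph V} {E : Type w}
  {p : E → TriangleSquareComplex G}

/-- The vertex of `G` below a vertex of the 1-skeleton of a cover. -/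
noncomputable def vertexBelow (e : {e : E // ∃ v : V, p e = vertexPoint G v}) : V := e.2.choose

theorem vertexPoint_vertexBelow (e : {e : E // ∃ v : V, p e = vertexPoint G v}) :
    p e.1 = vertexPoint G (vertexBelow e) := e.2.choose_spec

variable [TopologicalSpace E]

theorem exists_path_of_adj {e f : {e : E // ∃ v : V, p e = vertexPoint G v}}
    (hef : (oneSkeleton p).Adj e f) {a b : V} (he : p e.1 = vertexPoint G a)
    (hf : p f.1 = vertexPoint G b) :
    ∃ (h : G.Adj a b) (δ : Path e.1 f.1), ∀ t, p (δ t) = edgePoint h t := by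
  obtain ⟨a', b', h, γ, h0, h1, hγ⟩ := hef
  obtain rfl : a' = a := vertexPoint_injective (by rw [← he, ← h0, hγ, edgePoint_zero])
  obtain rfl : b' = b := vertexPoint_injective (by rw [← hf, ← h1, hγ, edgePoint_one])
  exact ⟨h, ⟨γ, h0, h1⟩, hγ⟩

theorem monodromy_of_adj (hp : IsCoveringMap p) {e f : {e : E // ∃ v : V, p e = vertexPoint G v}}
    (hef : (oneSkeleton p).Adj e f) {a b : V} (he : p e.1 = vertexPoint G a)
    (hf : p f.1 = vertexPoint G b) :
    ∃ h : G.Adj a b, hp.monodromy (edgeClass h) ⟨e.1, he⟩ = ⟨f.1, hf⟩ := by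
  obtain ⟨h, δ, hδ⟩ := exists_path_of_adj hef he hf
  refine ⟨h, hp.monodromy_eq_of_map_eq (.mk δ) ?_⟩
  change Path.Homotopic.Quotient.mk (δ.map hp.continuous) =
    Path.Homotopic.Quotient.mk ((edgePath h).cast he hf)
  exact congrArg _ (Path.ext (funext hδ))

theorem adj_of_monodromy (hp : IsCoveringMap p) {e f : {e : E // ∃ v : V, p e = vertexPoint G v}}
    {a b : V} (h : G.Adj a b) (he : p e.1 = vertexPoint G a) (hf : p f.1 = vertexPoint G b)
    (hm : hp.monodromy (edgeClass h) ⟨e.1, he⟩ = ⟨f.1, hf⟩) : (oneSkeleton p).Adj e f := by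
  have h0 : (edgePath h : C(unitInterval, TriangleSquareComplex G)) 0 = p e.1 := by
    rw [he]
    exact (edgePath h).source
  exact ⟨a, b, h, hp.liftPath (edgePath h) e.1 h0, hp.liftPath_zero _ _ _,
    congrArg Subtype.val hm, fun t => congrFun (hp.liftPath_lifts (edgePath h) e.1 h0) t⟩

/-- Adjacency in the 1-skeleton is monodromy along an edge. The two ways around a triangle or a
square are homotopic, so they have the same monodromy and the lifts close up. -/
theorem isCellCovering_vertexBelow (hp : IsCoveringMap p) :
    IsCellCovering (oneSkeleton p) G vertexBelow := by
  have lift : ∀ {e : {e : E // ∃ v : V, p e = vertexPoint G v}} {z : V}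
      (h : G.Adj (vertexBelow e) z), ∃ f : {e : E // ∃ v : V, p e = vertexPoint G v},
      (oneSkeleton p).Adj e f ∧ vertexBelow f = z ∧
        f.1 = (hp.monodromy (edgeClass h) ⟨e.1, vertexPoint_vertexBelow e⟩).1 := by
    intro e z h
    set f := hp.monodromy (edgeClass h) ⟨e.1, vertexPoint_vertexBelow e⟩ with hf
    have hz : p f.1 = vertexPoint G z := f.2
    refine ⟨⟨f.1, z, hz⟩, ?_, ?_, rfl⟩
    · exact adj_of_monodromy hp h (vertexPoint_vertexBelow e) hz hf.symm
    · refine vertexPoint_injective (G := G) ?_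
      rw [← vertexPoint_vertexBelow]
      exact hz
  have exists_lift : ∀ {e : {e : E // ∃ v : V, p e = vertexPoint G v}} {z : V},
      G.Adj (vertexBelow e) z → ∃ f, (oneSkeleton p).Adj e f ∧ vertexBelow f = z := by
    intro e z h
    obtain ⟨f, h₁, h₂, -⟩ := lift h
    exact ⟨f, h₁, h₂⟩
  have unique : ∀ {a b c : {e : E // ∃ v : V, p e = vertexPoint G v}},
      (oneSkeleton p).Adj a b → (oneSkeleton p).Adj a c → vertexBelow b = vertexBelow c →
      b = c := by
    intro a b c hab hac h
    obtain ⟨h₁, hb⟩ := monodromy_of_adj hp hab (vertexPoint_vertexBelow a)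
      (vertexPoint_vertexBelow b)
    obtain ⟨h₂, hc⟩ := monodromy_of_adj hp hac (vertexPoint_vertexBelow a)
      (h ▸ vertexPoint_vertexBelow c)
    exact Subtype.ext ((congrArg Subtype.val hb).symm.trans (congrArg Subtype.val hc))
  have triangle : ∀ {a b c : {e : E // ∃ v : V, p e = vertexPoint G v}},
      (oneSkeleton p).Adj a b → (oneSkeleton p).Adj a c →
      G.Adj (vertexBelow b) (vertexBelow c) → (oneSkeleton p).Adj b c := by
    intro a b c hab hac h
    obtain ⟨h₁, hb⟩ := monodromy_of_adj hp hab (vertexPoint_vertexBelow a)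
      (vertexPoint_vertexBelow b)
    obtain ⟨h₂, hc⟩ := monodromy_of_adj hp hac (vertexPoint_vertexBelow a)
      (vertexPoint_vertexBelow c)
    refine adj_of_monodromy hp h (vertexPoint_vertexBelow b) (vertexPoint_vertexBelow c) ?_
    rw [← hb, ← hc, ← edgeClass_triangle h₁ h h₂, hp.monodromy_trans_apply]
  refine ⟨fun hab => (monodromy_of_adj hp hab (vertexPoint_vertexBelow _)
    (vertexPoint_vertexBelow _)).1, exists_lift, unique, triangle, ?_⟩
  intro a b c z hab hac hbz hcz
  refine exists_square_lift_of_induced exists_lift unique triangle hab hac hbz hcz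
    fun hbc hbc' haz haz' => ?_
  obtain ⟨h₁, hb⟩ := monodromy_of_adj hp hab (vertexPoint_vertexBelow a)
      (vertexPoint_vertexBelow b)
  obtain ⟨h₂, hc⟩ := monodromy_of_adj hp hac (vertexPoint_vertexBelow a)
      (vertexPoint_vertexBelow c)
  obtain ⟨d, hbd, rfl, hd⟩ := lift hbz
  refine ⟨d, hbd, ?_, rfl⟩
  refine adj_of_monodromy hp hcz (vertexPoint_vertexBelow c) (vertexPoint_vertexBelow d) ?_
  apply Subtype.ext
  rw [hd, ← hc, ← hb, ← hp.monodromy_trans_apply, ← hp.monodromy_trans_apply,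
    edgeClass_square h₁ hbz h₂ hcz haz haz' hbc hbc']

theorem IsEdgeClass.reachable (hp : IsCoveringMap p) {x y : TriangleSquareComplex G}
    {q : Path.Homotopic.Quotient x y} (hq : IsEdgeClass q) (e : p ⁻¹' {x}) (f : p ⁻¹' {y})
    (he : ∃ v, p e.1 = vertexPoint G v) (hf : ∃ v, p f.1 = vertexPoint G v)
    (hm : hp.monodromy q e = f) : (oneSkeleton p).Reachable ⟨e.1, he⟩ ⟨f.1, hf⟩ := by
  induction hq with
  | refl v =>
    rw [hp.monodromy_refl] at hm
    subst hm
    rfl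
  | edge h => exact (adj_of_monodromy (e := ⟨e.1, he⟩) (f := ⟨f.1, hf⟩) hp h e.2 f.2 hm).reachable
  | @trans _ y _ q q' hq hq' ih ih' =>
    rw [hp.monodromy_trans_apply] at hm
    obtain ⟨u, hu⟩ := hq.exists_vertex.2
    have hg : ∃ v, p (hp.monodromy q e).1 = vertexPoint G v :=
      ⟨u, (hp.monodromy q e).2.trans hu.symm⟩
    exact (ih e _ he hg rfl).trans (ih' _ f hg hf hm)

/-- A path in `E` between two vertices projects to a path homotopic to an edge path, and the lift of
the latter has the same end and runs through adjacent vertices. -/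
theorem connected_oneSkeleton [PathConnectedSpace E] (hp : IsCoveringMap p)
    (hs : Function.Surjective p) [Nonempty V] : (oneSkeleton p).Connected := by
  have : Nonempty {e : E // ∃ v : V, p e = vertexPoint G v} := by
    obtain ⟨v⟩ := ‹Nonempty V›
    obtain ⟨e, he⟩ := hs (vertexPoint G v)
    exact ⟨⟨e, v, he⟩⟩
  refine ⟨fun e f => ?_⟩
  obtain ⟨e, v, he⟩ := e
  obtain ⟨f, w, hf⟩ := f
  obtain ⟨γ⟩ := PathConnectedSpace.joined e f
  have key : ∀ {x y : TriangleSquareComplex G} (hx : p e = x) (hy : p f = y),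
      IsEdgeClass ((Path.Homotopic.Quotient.mk (γ.map hp.continuous)).cast hx.symm hy.symm) →
      (oneSkeleton p).Reachable ⟨e, v, he⟩ ⟨f, w, hf⟩ := by
    rintro x y rfl rfl h
    rw [Path.Homotopic.Quotient.cast_rfl_rfl] at h
    exact h.reachable hp ⟨e, rfl⟩ ⟨f, rfl⟩ ⟨v, he⟩ ⟨w, hf⟩ (hp.monodromy_map (.mk γ))
  exact key he hf (isEdgeClass _)

end OneSkeleton


/-! ### Sections of cell coverings by path lifting -/

section Section

variable {V : Type u} {U W : Type w} {G : SimpleGraph V} {K : SimpleGraph W} {H : SimpleGraph U}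
  {f : W → V} {q : U → W} {E : Type*} [TopologicalSpace E] {p : E → TriangleSquareComplex G}
  {ι : W → E}

/-- The vertices and edges of a graph `K` over `G` are points and paths of a space `E` over the
triangle-square complex of `G`, compatibly with the projections. -/
structure IsCarried (K : SimpleGraph W) (f : W → V) (p : E → TriangleSquareComplex G)
    (ι : W → E) : Prop where
  continuous : Continuous p
  map_apply : ∀ a, p (ι a) = vertexPoint G (f a)
  exists_path : ∀ {a b : W}, K.Adj a b →
    ∃ (h : G.Adj (f a) (f b)) (δ : Path (ι a) (ι b)), ∀ t, p (δ t) = edgePoint h t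

/-- The vertex `a` of `H` is the end of the lift starting at `a₀` of the image of some path of `E`
from `e₀` to `e`. -/
def IsLiftEnd (hf : IsCellCovering H G (f ∘ q)) (p : E → TriangleSquareComplex G) (ι : W → E)
    (a₀ : U) (e : W) (a : U) : Prop :=
  ∃ (γ : Path (ι (q a₀)) (ι e)) (Γ : Path (vertexPoint H a₀) (vertexPoint H a)),
    ∀ t, hf.map (Γ t) = p (γ t)

theorem IsLiftEnd.step {hf : IsCellCovering H G (f ∘ q)} (hK : IsCarried K f p ι) {a₀ a a' : U}
    {e : W} (h : IsLiftEnd hf p ι a₀ e a) (hqa : q a = e) (ha : H.Adj a a')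
    (hq : K.Adj (q a) (q a')) : IsLiftEnd hf p ι a₀ (q a') a' := by
  subst hqa
  obtain ⟨γ, Γ, hγ⟩ := h
  obtain ⟨_, δ, hδ⟩ := hK.exists_path hq
  refine ⟨γ.trans δ, Γ.trans (edgePath ha), trans_apply_congr hγ fun t => ?_⟩
  exact (hf.map_edgePoint ha t).trans (hδ t).symm

/-- The two paths in `E` are homotopic because `E` is simply connected. Their projections to the
complex of `G` are then homotopic too, and lifts of homotopic paths to the complex of `H` have the
same end. -/
theorem IsLiftEnd.eq [SimplyConnectedSpace E] {hf : IsCellCovering H G (f ∘ q)}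
    (hs : Function.Surjective (f ∘ q)) (hp : Continuous p) {a₀ a a' : U} {e : W}
    (h : IsLiftEnd hf p ι a₀ e a) (h' : IsLiftEnd hf p ι a₀ e a') : a = a' := by
  obtain ⟨γ, Γ, hγ⟩ := h
  obtain ⟨γ', Γ', hγ'⟩ := h'
  have hF := hf.isCoveringMap hs
  have h0 : p (ι (q a₀)) = hf.map (vertexPoint H a₀) := by
    have := hγ 0
    rw [Γ.source, γ.source] at this
    exact this.symm
  have h1 : (γ.map hp).toContinuousMap 0 = hf.map (vertexPoint H a₀) :=
    (γ.map hp).source.trans h0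
  have h1' : (γ'.map hp).toContinuousMap 0 = hf.map (vertexPoint H a₀) :=
    (γ'.map hp).source.trans h0
  have hhom : (γ.map hp).toContinuousMap.HomotopicRel (γ'.map hp).toContinuousMap {0, 1} :=
    (SimplyConnectedSpace.paths_homotopic γ γ').map ⟨p, hp⟩
  have e1 : Γ.toContinuousMap = hF.liftPath (γ.map hp).toContinuousMap _ h1 :=
    (hF.eq_liftPath_iff' h1).2 ⟨funext hγ, Γ.source⟩
  have e1' : Γ'.toContinuousMap = hF.liftPath (γ'.map hp).toContinuousMap _ h1' :=
    (hF.eq_liftPath_iff' h1').2 ⟨funext hγ', Γ'.source⟩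
  have key := hF.liftPath_apply_one_eq_of_homotopicRel hhom _ h1 h1'
  rw [← e1, ← e1'] at key
  exact vertexPoint_injective (Γ.target.symm.trans (key.trans Γ'.target))

/-- A cell covering of a graph carried by a simply connected space has a section. -/
theorem exists_section [SimplyConnectedSpace E] (hfK : IsCellCovering K G f)
    (hq : IsCellCovering H K q) (hK : IsCarried K f p ι) (hG : G.Connected) (hKc : K.Connected)
    (a₀ : U) : ∃ φ : W → U, (∀ e, q (φ e) = e) ∧ φ (q a₀) = a₀ ∧
      ∀ {e e'}, K.Adj e e' → H.Adj (φ e) (φ e') := by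
  have hf := hfK.comp hq
  have hs := hf.surjective hG a₀
  have hrefl : IsLiftEnd hf p ι a₀ (q a₀) a₀ :=
    ⟨.refl _, .refl _, fun _ => (hf.map_vertexPoint a₀).trans (hK.map_apply _).symm⟩
  have hex : ∀ {e e' : W}, K.Walk e e' → (∃ a, IsLiftEnd hf p ι a₀ e a ∧ q a = e) →
      ∃ a, IsLiftEnd hf p ι a₀ e' a ∧ q a = e' := by
    intro e e' c h
    induction c with
    | nil => exact h
    | cons he _ ih =>
      obtain ⟨a, ha, rfl⟩ := h
      obtain ⟨a', haa', rfl⟩ := hq.exists_lift he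
      exact ih ⟨a', ha.step hK rfl haa' he, rfl⟩
  choose φ hφ hqφ using fun e => (hKc (q a₀) e).elim fun c => hex c ⟨a₀, hrefl, rfl⟩
  refine ⟨φ, hqφ, (hφ _).eq hs hK.continuous hrefl, fun {e e'} he => ?_⟩
  -- The lift of `e'` next to `φ e` is also the end of a lifted path, hence equal to `φ e'`.
  obtain ⟨a', haa', rfl⟩ := hq.exists_lift (a := φ e) (by rwa [hqφ e])
  have := (hφ e).step hK (hqφ e) haa' (by rwa [hqφ e])
  rwa [(hφ (q a')).eq hs hK.continuous this]

end Section

/-! ### Weak modularity read off from the unfoldings -/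

namespace Unfolding

variable {V : Type u} {G : SimpleGraph V} {v₀ : V}

theorem dist_proj_le_level (hG : G.Connected) {n : ℕ} {a : Unfolding G v₀} (h : a.level = n) :
    G.dist v₀ a.proj ≤ n := by
  induction n generalizing a with
  | zero =>
    rw [eq_base_of_level h]
    exact SimpleGraph.dist_self.le
  | succ n ih =>
    obtain ⟨b, hab, hb⟩ := exists_adj_of_level h
    have h₁ : G.dist b.proj a.proj = 1 := SimpleGraph.dist_eq_one_iff_adj.2 (IsAdj.proj hab).symm
    have := hG.dist_triangle (u := v₀) (v := b.proj) (w := a.proj)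
    have := ih hb
    omega

variable {φ : V → Unfolding G v₀}

/-- Descending layer by layer from `φ v` and projecting gives a walk to `v₀` of length the level.
Conversely, the image of a geodesic under the section climbs at most one layer per edge. -/
theorem dist_eq_level (hG : G.Connected) (hφ : ∀ v, (φ v).proj = v) (h₀ : φ v₀ = base G v₀)
    (hadj : ∀ {v w}, G.Adj v w → (graph G v₀).Adj (φ v) (φ w)) (v : V) :
    G.dist v₀ v = (φ v).level := by
  apply le_antisymm
  · have := dist_proj_le_level hG (rfl : (φ v).level = _)
    rwa [hφ] at this
  · have key : ∀ {u w : V} (c : G.Walk u w), (φ w).level ≤ (φ u).level + c.length := by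
      intro u w c
      induction c with
      | nil => exact le_rfl
      | cons h c ih =>
        have := level_le_of_adj (hadj h)
        rw [SimpleGraph.Walk.length_cons]
        omega
    obtain ⟨c, hc⟩ := hG.exists_walk_length_eq_dist v₀ v
    have := key c
    rw [h₀, hc] at this
    exact this.trans (Nat.zero_add _).le

/-- If all the unfoldings of a locally weakly modular graph have sections, then the graph is weakly
modular. -/
theorem isWeaklyModular_of_section (hG : G.Connected) (hl : IsLocallyWeaklyModular G)
    (hs : ∀ v₀, ∃ φ : V → Unfolding G v₀, (∀ v, (φ v).proj = v) ∧ φ v₀ = base G v₀ ∧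
      ∀ {v w}, G.Adj v w → (graph G v₀).Adj (φ v) (φ w)) : IsWeaklyModular G := by
  intro u
  obtain ⟨φ, hφ, h₀, hadj⟩ := hs u
  have hd := dist_eq_level hG hφ h₀ hadj
  have below : ∀ {v w : V} {c : Unfolding G u}, (graph G u).Adj c (φ v) → (graph G u).Adj c (φ w) →
      c.level + 1 = (φ v).level →
      ∃ x : V, G.Adj x v ∧ G.Adj x w ∧ G.dist u x + 1 = G.dist u v := by
    intro v w c hv hw hc
    have hv' : G.Adj c.proj v := hφ v ▸ IsAdj.proj hv
    have hw' : G.Adj c.proj w := hφ w ▸ IsAdj.proj hw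
    refine ⟨c.proj, hv', hw', ?_⟩
    have h₁ := dist_proj_le_level hG (rfl : c.level = _)
    have h₂ := hG.dist_triangle (u := u) (v := c.proj) (w := v)
    rw [SimpleGraph.dist_eq_one_iff_adj.2 hv', hd v] at h₂
    rw [hd v]
    omega
  constructor
  · intro v w hvw _ hl'
    rw [SimpleGraph.dist_eq_one_iff_adj] at hvw
    obtain ⟨c, hv, hw, hc⟩ := exists_below_of_adj (hadj hvw) (by rw [← hd, ← hd, hl'])
    exact below hv hw hc
  · intro v w z hvz hwz hvw _ hl' hz
    rw [SimpleGraph.dist_eq_one_iff_adj] at hvz hwz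
    have hne : φ v ≠ φ w := by
      intro h
      have := congrArg proj h
      rw [hφ, hφ] at this
      rw [this, SimpleGraph.dist_self] at hvw
      omega
    obtain ⟨c, hv, hw, hc⟩ := exists_below_of_adj_adj hl (hadj hvz) (hadj hwz)
      (by rw [← hd, ← hd, hz]) (by rw [← hd, ← hd, hz, hl']) hne
    exact below hv hw hc

end Unfolding

/-! ### The theorem -/

section Main

variable {V : Type u} {W : Type w} {G : SimpleGraph V} {K : SimpleGraph W} {f : W → V}

/-- The common form of both applications. Working with a graph carried by `E` avoids identifying the
universal cover with the triangle-square complex of its own 1-skeleton. -/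
theorem IsCarried.isWeaklyModular {E : Type*} [TopologicalSpace E] [SimplyConnectedSpace E]
    {p : E → TriangleSquareComplex G} {ι : W → E} (hK : IsCarried K f p ι)
    (hf : IsCellCovering K G f) (hG : G.Connected) (hKc : K.Connected)
    (hl : IsLocallyWeaklyModular G) : IsWeaklyModular K := by
  have hKl := hf.isLocallyWeaklyModular hl
  exact Unfolding.isWeaklyModular_of_section hKc hKl fun v₀ =>
    exists_section hf (Unfolding.isCellCovering hKl) hK hG hKc (Unfolding.base K v₀)

theorem isCarried_vertexPoint : IsCarried G id id (vertexPoint G) :=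
  ⟨continuous_id, fun _ => rfl, fun h => ⟨h, edgePath h, fun _ => rfl⟩⟩

theorem isCellCovering_id : IsCellCovering G G id where
  map_adj h := h
  exists_lift h := ⟨_, h, rfl⟩
  unique _ _ h := h
  triangle _ _ h := h
  square _ _ h h' := ⟨_, h, h', rfl⟩

theorem IsUniversalCover.isCarried {E : Type w} [TopologicalSpace E]
    {p : E → TriangleSquareComplex G} (hp : IsUniversalCover p) :
    IsCarried (oneSkeleton p) vertexBelow p Subtype.val :=
  ⟨hp.isCoveringMap.continuous, vertexPoint_vertexBelow, fun h =>
    exists_path_of_adj h (vertexPoint_vertexBelow _) (vertexPoint_vertexBelow _)⟩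

end Main

end WeakMod

theorem theoremt {V : Type u} (G : SimpleGraph V) (hG : G.Connected) :
    (WeakMod.IsLocallyWeaklyModular G →
      ∀ (E : Type w) [TopologicalSpace E] (p : E → WeakMod.TriangleSquareComplex G),
        WeakMod.IsUniversalCover p →
          (WeakMod.oneSkeleton p).Connected ∧
            WeakMod.IsWeaklyModular (WeakMod.oneSkeleton p)) ∧
    (WeakMod.IsWeaklyModular G ↔
      WeakMod.IsLocallyWeaklyModular G ∧
        SimplyConnectedSpace (WeakMod.TriangleSquareComplex G)) := by
  refine ⟨fun hl E _ p hp => ?_, fun h => ⟨h.isLocallyWeaklyModular, h.simplyConnectedSpace hG⟩,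
    -- A simply connected complex serves as its own carrier, with identity projections.
    fun ⟨hl, _⟩ => WeakMod.isCarried_vertexPoint.isWeaklyModular WeakMod.isCellCovering_id hG hG hl⟩
  have := hp.simplyConnected
  have := hG.nonempty
  have hc := WeakMod.connected_oneSkeleton hp.isCoveringMap hp.surjective
  exact ⟨hc, hp.isCarried.isWeaklyModular
    (WeakMod.isCellCovering_vertexBelow hp.isCoveringMap) hG hc hl⟩
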